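/- Let $W=\{0,1\}^*$ be the set of binary words. For $k\ge 1$, a function $f:W^k\to\mathbb N$ is in $\#\mathsf P$ if there are a polynomial-time decidable language $B\subseteq W^{k+1}$ and a polynomial $q$ such that for all $w\in W^k$ one has $f(w)=\#\{u\in W:(w,u)\in B\}$, and $(w,u)\in B$ implies $|u|\le q(|w|)$ (here $|w|$ is the length of the code of the tuple $w$). Put $\mathsf{GapP}=\#\mathsf P-\#\mathsf P$. Let $X=\bigcup_n X_n$ with $X_n\subseteq\{0,1\}^n$, and let $\mathcal P=(X,\preccurlyeq)$ be a poset such that $x\preccurlyeq y$ only if $x,y\in X_n$ for some $n$. A function $X^2\to\mathbb Z$ is said to be in $\mathsf{GapP}$ if its extension by zero to $W^2$ is in $\mathsf{GapP}$. Suppose that * $\mathcal P$ has polynomial height: there are constants $C,c$ such that for all $n\ge 1$ every chain in $X_n$ has at most $C\,n^c$ elements; * the incidence relation is poly-time computable: there is a Turing machine that, given $x,y\in X_n$ for any $n$, decides whether $x\preccurlyeq y$ in time polynomial in $n$. Let $\eta:X^2\to\mathbb Z$ be unitriangular, that is, $\eta(x,x)=1$ for all $x\in X$, and $\eta(x,y)\ne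 0$ implies $x\preccurlyeq y$. Suppose that $\eta$ is in $\mathsf{GapP}$. Then $\eta$ has a unique inverse in the incidence algebra, i.e. there is a unique function $\rho:X^2\to\mathbb Z$ such that $\rho(x,y)\neq 0$ only if $x\preccurlyeq y$, and $$\sum_{z\in X_n}\eta(x,z)\,\rho(z,y)=\delta(x,y)\qquad\text{for all } n \text{ and all } x,y\in X_n,$$ where $\delta(x,y)=1$ if $x=y$ and $\delta(x,y)=0$ otherwise; and this $\rho$ is in $\mathsf{GapP}$. -/

import Mathlib

/-- Words over the alphabet `{0,1}`. -/
abbrev Word := List Bool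

/-- The code of a finite sequence of words over the alphabet `{0, 1, #}` (with `#` the letter
`none`): the words are written one after the other, each followed by `#`. -/
def encodeWords (ws : List Word) : List (Option Bool) :=
  ws.flatMap fun w => w.map some ++ [none]

/-- The code of a `k`-tuple of words. -/
def encodeTuple {k : ℕ} (w : Fin k → Word) : List (Option Bool) :=
  encodeWords (List.ofFn w)

open Classical in
/-- The instances `a : α`, given to the machine as `enc a`, of the decision problem `p` are decided
by a multi-tape Turing machine in time polynomial in the length of `enc a`. Nothing is asked of the
machine on inputs that are not the code of an instance. -/
def PolyTimeDecidable {α : Type} (enc : α → List (Option Bool)) (p : α → Prop) : Prop :=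
  Nonempty (Turing.TM2ComputableInPolyTime enc Computability.encodeBool fun a => decide (p a))

/-- `f : W^k → ℕ` is in `#P`: there are a polynomial-time decidable language `B ⊆ W^(k+1)` and a
polynomial `q` such that `(w, u) ∈ B` only if `|u| ≤ q(|w|)`, and `f w = #{u : (w, u) ∈ B}`. -/
def IsSharpP {k : ℕ} (f : (Fin k → Word) → ℕ) : Prop :=
  ∃ (B : Set (Fin (k + 1) → Word)) (q : Polynomial ℕ),
    PolyTimeDecidable encodeTuple (fun v => v ∈ B) ∧
    ∀ w : Fin k → Word,
      (∀ u : Word, (Fin.snoc w u : Fin (k + 1) → Word) ∈ B →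
        u.length ≤ q.eval (encodeTuple w).length) ∧
      f w = Set.ncard {u : Word | (Fin.snoc w u : Fin (k + 1) → Word) ∈ B}

/-- `GapP = #P - #P`. -/
def IsGapP {k : ℕ} (f : (Fin k → Word) → ℤ) : Prop :=
  ∃ g h : (Fin k → Word) → ℕ, IsSharpP g ∧ IsSharpP h ∧ ∀ w, f w = (g w : ℤ) - (h w : ℤ)

/-- A poset on a set of words in which only words of the same length are comparable. -/
structure WordPoset where
  /-- The ground set `X`. -/
  carrier : Set Word
  /-- The weak order relation on `X`. -/
  le : carrier → carrier → Prop
  le_refl : ∀ x, le x x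
  le_trans : ∀ x y z, le x y → le y z → le x z
  le_antisymm : ∀ x y, le x y → le y x → x = y
  length_eq : ∀ x y, le x y → x.1.length = y.1.length

namespace WordPoset

theorem finite_level (P : WordPoset) (n : ℕ) : {x : P.carrier | x.1.length = n}.Finite :=
  Set.Finite.preimage Subtype.val_injective.injOn (List.finite_length_eq Bool n)

/-- `X_n`, the elements of `X` of length `n`. -/
noncomputable def level (P : WordPoset) (n : ℕ) : Finset P.carrier :=
  (P.finite_level n).toFinset

/-- The largest size of a chain in `X_n` is at most `C * n ^ c`. (The level `X_0` has at most one
element, and is left out because `0 ^ c` may be `0`.) -/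
def PolynomialHeight (P : WordPoset) : Prop :=
  ∃ C c : ℕ, ∀ n : ℕ, 1 ≤ n →
    Set.chainHeight (P.level n : Set P.carrier) P.le ≤ ((C * n ^ c : ℕ) : ℕ∞)

/-- For `x, y` in the same `X_n`, it can be decided in time polynomial in `n` whether `x ≼ y`. -/
def PolyTimeIncidence (P : WordPoset) : Prop :=
  PolyTimeDecidable
    (fun p : {p : P.carrier × P.carrier // p.1.1.length = p.2.1.length} =>
      encodeWords [p.1.1.1, p.1.2.1])
    (fun p => P.le p.1.1 p.1.2)

/-- Membership in the incidence algebra: `f(x, y) ≠ 0` only if `x ≼ y`. -/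
def InIncidenceAlgebra (P : WordPoset) (f : P.carrier → P.carrier → ℤ) : Prop :=
  ∀ x y, f x y ≠ 0 → P.le x y

def Unitriangular (P : WordPoset) (η : P.carrier → P.carrier → ℤ) : Prop :=
  P.InIncidenceAlgebra η ∧ ∀ x, η x x = 1

open Classical in
/-- `ρ` is the inverse of `η` in the incidence algebra. -/
def IsInverse (P : WordPoset) (η ρ : P.carrier → P.carrier → ℤ) : Prop :=
  P.InIncidenceAlgebra ρ ∧
    ∀ n : ℕ, ∀ x ∈ P.level n, ∀ y ∈ P.level n,
      ∑ z ∈ P.level n, η x z * ρ z y = if x = y then 1 else 0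

open Classical in
/-- The function on all pairs of words that extends `f` by zero. -/
noncomputable def extend (P : WordPoset) (f : P.carrier → P.carrier → ℤ) (w : Fin 2 → Word) : ℤ :=
  if h : w 0 ∈ P.carrier ∧ w 1 ∈ P.carrier then f ⟨w 0, h.1⟩ ⟨w 1, h.2⟩ else 0

/-- A function on `X × X` is in `GapP` if its extension by zero to all pairs of words is. -/
def GapPOn (P : WordPoset) (f : P.carrier → P.carrier → ℤ) : Prop :=
  IsGapP (P.extend f)

end WordPoset

/-!
On words of length `n`, write the extension by zero of `η` as the matrix `E + N`, with `E` the
diagonal part (the projection to `X`) and `N` the off-diagonal part. The inverse is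
`ρ = ∑ (-N)ˡ E`, the alternating sum over strict chains `x = x₀ ≺ ⋯ ≺ x_l = y` of the products
`η(x₀, x₁) ⋯ η(x_{l-1}, x_l)`. The sum may be cut off at any `k` that exceeds the length of all
chains (`WordPoset.IsInverse.eq_chainSum`, `WordPoset.Unitriangular.isInverse_chainSum`), and by
polynomial height a power of `n + 1` suffices. Since `η` vanishes on incomparable pairs and on pairs
outside of `X`, the sum may range over all sequences of words of length `n` with `xᵢ ≠ xᵢ₊₁`, so
neither `X` nor the incidence relation has to be recognized.

Let `η = g₀ - g₁` with `g₀, g₁` in `#P`, counting the witnesses for relations `B₀` and `B₁`.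
Multiplying out, `ρ(x, y)` counts with signs the sequences of triples `(sᵢ, xᵢ₊₁, vᵢ)` with a bit
`sᵢ` and a witness `vᵢ` for `B_{sᵢ}(xᵢ, xᵢ₊₁)`. The last triple has `x_{l+1} = x_l` and accounts for
the factor `E`; the sign is `(-1)^(l + m)`, with `m` the number of `i` such that `sᵢ = 1`. Such a sequence
is written as one word (`Certifies`), and the words of either sign are counted by a function in `#P`
(`Certifies.ncard_sub_ncard`, `isGapP_chainSum`).

That certificates can be checked in polynomial time (`polyTimeDecidable_certifies`) is shown by an
explicit multi-tape machine (`ChainMachine.machine`). It has the deciders of `B₀` and `B₁` as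
subroutines (`Turing.TM2.Represents.reachIn`), runs one of them for each triple, and keeps the length
of the sequence below `(n + 1) ^ c` with an odometer of `c` digits in base `n + 1`
(`ChainMachine.tick_run`). Before it halts it has to empty its tapes, which takes polynomial time
because stacks grow at most linearly with time (`Turing.FinTM2.exists_length_le`).
-/

/-! ### Runs of machines, and machines inside of larger machines -/

/-- `f` leads from `a` to `b` in exactly `n` steps. -/
def ReachIn {α : Type*} (f : α → Option α) : ℕ → α → α → Prop
  | 0, a, b => a = b
  | n + 1, a, b => ∃ c, f a = some c ∧ ReachIn f n c b

namespace ReachIn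

variable {α : Type*} {f : α → Option α}

theorem trans {m n : ℕ} {a b c : α} (h₁ : ReachIn f m a b) (h₂ : ReachIn f n b c) :
    ReachIn f (m + n) a c := by
  induction m generalizing a with
  | zero => cases h₁; simpa using h₂
  | succ m ih =>
    obtain ⟨d, hd, h₁⟩ := h₁
    rw [Nat.succ_add]
    exact ⟨d, hd, ih h₁⟩

theorem iff_iterate {n : ℕ} {a b : α} :
    ReachIn f n a b ↔ (flip bind f)^[n] (some a) = some b := by
  have hnone : ∀ n, (flip bind f)^[n] (none : Option α) = none := by
    intro n
    induction n with
    | zero => rfl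
    | succ n ih => exact ih
  induction n generalizing a with
  | zero => simp [ReachIn]
  | succ n ih =>
    rw [Function.iterate_succ_apply]
    have h : flip bind f (some a) = f a := rfl
    rw [h]
    constructor
    · rintro ⟨c, hc, h⟩
      rw [hc]
      exact ih.1 h
    · intro h
      cases hc : f a with
      | none => rw [hc, hnone] at h; cases h
      | some c => exact ⟨c, hc, ih.2 (hc ▸ h)⟩

end ReachIn

namespace Turing

/-- The number of `push` instructions in a statement, an upper bound for the growth of any stack
when the statement is executed. -/
def TM2.Stmt.pushes {K : Type} {Γ : K → Type} {Λ σ : Type} : TM2.Stmt Γ Λ σ → ℕ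
  | .push _ _ q => q.pushes + 1
  | .peek _ _ q => q.pushes
  | .pop _ _ q => q.pushes
  | .load _ q => q.pushes
  | .branch _ q₁ q₂ => q₁.pushes + q₂.pushes
  | .goto _ => 0
  | .halt => 0

theorem TM2.length_stepAux_le {K : Type} [DecidableEq K] {Γ : K → Type} {Λ σ : Type}
    (q : TM2.Stmt Γ Λ σ) (v : σ) (S : ∀ k, List (Γ k)) (k : K) :
    ((TM2.stepAux q v S).stk k).length ≤ (S k).length + q.pushes := by
  induction q generalizing v S with
  | push j f q ih =>
    refine (ih _ _).trans ?_
    by_cases h : k = j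
    · subst h; simp [TM2.Stmt.pushes]; omega
    · simp [h, TM2.Stmt.pushes]
  | pop j f q ih =>
    refine (ih _ _).trans ?_
    by_cases h : k = j
    · subst h; simp [TM2.Stmt.pushes]
    · simp [h, TM2.Stmt.pushes]
  | peek j f q ih => exact ih _ _
  | load f q ih => exact ih _ _
  | branch f q₁ q₂ ih₁ ih₂ =>
    simp only [TM2.stepAux, TM2.Stmt.pushes]
    cases f v
    · exact (ih₂ _ _).trans (by omega)
    · exact (ih₁ _ _).trans (by omega)
  | goto f => simp [TM2.Stmt.pushes]
  | halt => simp [TM2.Stmt.pushes]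

/-- The stacks of a machine grow at most linearly with the number of steps. -/
theorem FinTM2.exists_length_le (tm : FinTM2) :
    ∃ W : ℕ, ∀ (n : ℕ) (a b : tm.Cfg), ReachIn tm.step n a b →
      ∀ k, (b.stk k).length ≤ (a.stk k).length + n * W := by
  let := tm.ΛFin
  refine ⟨∑ l, (tm.m l).pushes, fun n => ?_⟩
  induction n with
  | zero => rintro a b h k; cases h; simp
  | succ n ih =>
    rintro ⟨l, v, S⟩ b ⟨c, hc, h⟩ k
    cases l with
    | none => cases hc
    | some l =>
      obtain rfl : TM2.stepAux (tm.m l) v S = c := Option.some.inj hc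
      have h₁ := ih _ _ h k
      have h₂ := TM2.length_stepAux_le (tm.m l) v S k
      have h₃ : (tm.m l).pushes ≤ ∑ l, (tm.m l).pushes :=
        Finset.single_le_sum (f := fun l => (tm.m l).pushes) (fun _ _ => Nat.zero_le _)
          (Finset.mem_univ l)
      rw [Nat.succ_mul]
      exact h₁.trans (by dsimp only; omega)

section Embedding

variable {K K' : Type} [DecidableEq K] [DecidableEq K'] {Γ' : K' → Type} {Λ Λ' σ σ' : Type}

/-- The statement of a larger machine that acts as a given statement on the stacks `ι k` and on a
part of the internal state, read by `get` and overwritten by `set`. Labels are translated by `lab`,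
and instead of halting the larger machine continues at the label `ret`. -/
def TM2.Stmt.embed (ι : K → K') (get : σ' → σ) (set : σ → σ' → σ') (lab : Λ → Λ') (ret : Λ') :
    TM2.Stmt (fun k => Γ' (ι k)) Λ σ → TM2.Stmt Γ' Λ' σ'
  | .push k f q => .push (ι k) (fun v => f (get v)) (q.embed ι get set lab ret)
  | .peek k f q => .peek (ι k) (fun v o => set (f (get v) o) v) (q.embed ι get set lab ret)
  | .pop k f q => .pop (ι k) (fun v o => set (f (get v) o) v) (q.embed ι get set lab ret)
  | .load f q => .load (fun v => set (f (get v)) v) (q.embed ι get set lab ret)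
  | .branch f q₁ q₂ => .branch (fun v => f (get v)) (q₁.embed ι get set lab ret)
      (q₂.embed ι get set lab ret)
  | .goto f => .goto fun v => lab (f (get v))
  | .halt => .goto fun _ => ret

/-- The configuration `c'` of the larger machine represents the configuration `c` of the embedded
machine, while all the rest is as in the state `v₀` and the stacks `S₀`. -/
structure TM2.Represents (ι : K → K') (set : σ → σ' → σ') (lab : Λ → Λ') (ret : Λ') (v₀ : σ')
    (S₀ : ∀ k, List (Γ' k)) (c : TM2.Cfg (fun k => Γ' (ι k)) Λ σ) (c' : TM2.Cfg Γ' Λ' σ') :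
    Prop where
  label : c'.l = some (c.l.elim ret lab)
  var : c'.var = set c.var v₀
  stk : ∀ k, c'.stk (ι k) = c.stk k
  frame : ∀ k', k' ∉ Set.range ι → c'.stk k' = S₀ k'

variable {ι : K → K'} {get : σ' → σ} {set : σ → σ' → σ'} {lab : Λ → Λ'} {ret : Λ'} {v₀ : σ'}
  {S₀ : ∀ k, List (Γ' k)}

theorem TM2.represents_stepAux (hι : Function.Injective ι) (hgs : ∀ a v, get (set a v) = a)
    (hss : ∀ a b v, set a (set b v) = set a v) (q : TM2.Stmt (fun k => Γ' (ι k)) Λ σ) (v : σ)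
    (S : ∀ k, List (Γ' (ι k))) (S' : ∀ k, List (Γ' k)) (hS : ∀ k, S' (ι k) = S k)
    (hF : ∀ k', k' ∉ Set.range ι → S' k' = S₀ k') :
    Represents ι set lab ret v₀ S₀ (TM2.stepAux q v S)
      (TM2.stepAux (q.embed ι get set lab ret) (set v v₀) S') := by
  have upd : ∀ (S : ∀ k, List (Γ' (ι k))) (S' : ∀ k, List (Γ' k)), (∀ k, S' (ι k) = S k) →
      ∀ (k : K) (x : List (Γ' (ι k))) (j : K),
      Function.update S' (ι k) x (ι j) = Function.update S k x j := by
    intro S S' hS k x j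
    by_cases h : j = k
    · subst h; simp
    · simp [h, hι.ne h, hS]
  have updF : ∀ (S' : ∀ k, List (Γ' k)), (∀ k', k' ∉ Set.range ι → S' k' = S₀ k') →
      ∀ (k : K) (x : List (Γ' (ι k))) (k' : K'), k' ∉ Set.range ι →
      Function.update S' (ι k) x k' = S₀ k' := by
    intro S' hF k x k' hk'
    rw [Function.update_of_ne (fun h => hk' ⟨k, h.symm⟩), hF k' hk']
  induction q generalizing v S S' with
  | push k f q ih =>
    simp only [TM2.Stmt.embed, TM2.stepAux, hgs, hS]
    exact ih _ _ _ (upd _ _ hS _ _) (updF _ hF _ _)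
  | peek k f q ih =>
    simp only [TM2.Stmt.embed, TM2.stepAux, hgs, hS, hss]
    exact ih _ _ _ hS hF
  | pop k f q ih =>
    simp only [TM2.Stmt.embed, TM2.stepAux, hgs, hS, hss]
    exact ih _ _ _ (upd _ _ hS _ _) (updF _ hF _ _)
  | load f q ih =>
    simp only [TM2.Stmt.embed, TM2.stepAux, hgs, hss]
    exact ih _ _ _ hS hF
  | branch f q₁ q₂ ih₁ ih₂ =>
    simp only [TM2.Stmt.embed, TM2.stepAux, hgs]
    cases f v
    · exact ih₂ _ _ _ hS hF
    · exact ih₁ _ _ _ hS hF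
  | goto f => exact ⟨by simp [TM2.Stmt.embed, hgs], rfl, hS, hF⟩
  | halt => exact ⟨rfl, rfl, hS, hF⟩

/-- A run of the embedded machine is reproduced step by step by the larger machine. -/
theorem TM2.Represents.reachIn (hι : Function.Injective ι) (hgs : ∀ a v, get (set a v) = a)
    (hss : ∀ a b v, set a (set b v) = set a v)
    {m : Λ → TM2.Stmt (fun k => Γ' (ι k)) Λ σ} {m' : Λ' → TM2.Stmt Γ' Λ' σ'}
    (hm : ∀ l, m' (lab l) = (m l).embed ι get set lab ret) {n : ℕ}
    {a b : TM2.Cfg (fun k => Γ' (ι k)) Λ σ} {a' : TM2.Cfg Γ' Λ' σ'}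
    (ha : Represents ι set lab ret v₀ S₀ a a') (h : ReachIn (TM2.step m) n a b) :
    ∃ b', Represents ι set lab ret v₀ S₀ b b' ∧ ReachIn (TM2.step m') n a' b' := by
  induction n generalizing a a' with
  | zero => cases h; exact ⟨a', ha, rfl⟩
  | succ n ih =>
    obtain ⟨c, hc, h⟩ := h
    obtain ⟨l, v, S⟩ := a
    obtain ⟨l', v', S'⟩ := a'
    obtain ⟨h₁, h₂, h₃, h₄⟩ := ha
    cases l with
    | none => cases hc
    | some l =>
      obtain rfl : TM2.stepAux (m l) v S = c := Option.some.inj hc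
      dsimp only [Option.elim] at h₁ h₂ h₃ h₄
      subst h₁ h₂
      obtain ⟨b', hb', hr⟩ := ih (represents_stepAux (lab := lab) (ret := ret) (v₀ := v₀)
        hι hgs hss (m l) v S S' h₃ h₄) h
      exact ⟨b', hb', _, by rw [TM2.step, hm], hr⟩

end Embedding

end Turing

/-! ### The machine that checks certificates -/

namespace ChainMachine

open Turing

/-- The work tapes: the input, two copies of the current word (`cur` and `cmp`), a scratch tape
`tmp`, the reversed target word, the reversed query, and the digits of the odometer. The `d`-th
digit is the number of symbols on `lo d`; the symbols on `lo d` and `hi d` together are as many as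
the letters of the current word. -/
inductive Tape (c : ℕ)
  | inp | cur | cmp | tmp | tgt | qry
  | lo (d : Fin c)
  | hi (d : Fin c)
  deriving DecidableEq, Fintype

/-- The contents of the work tapes. -/
structure Tapes (c : ℕ) where
  inp : List (Option Bool)
  cur : List (Option Bool)
  cmp : List (Option Bool)
  tmp : List (Option Bool)
  tgt : List (Option Bool)
  qry : List (Option Bool)
  lo : Fin c → List (Option Bool)
  hi : Fin c → List (Option Bool)

namespace Tapes

variable {c : ℕ}

/-- The contents of a tape. -/
def get (S : Tapes c) : Tape c → List (Option Bool)
  | .inp => S.inp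
  | .cur => S.cur
  | .cmp => S.cmp
  | .tmp => S.tmp
  | .tgt => S.tgt
  | .qry => S.qry
  | .lo d => S.lo d
  | .hi d => S.hi d

/-- Replace the contents of a tape. -/
def set (S : Tapes c) (t : Tape c) (l : List (Option Bool)) : Tapes c :=
  match t with
  | .inp => { S with inp := l }
  | .cur => { S with cur := l }
  | .cmp => { S with cmp := l }
  | .tmp => { S with tmp := l }
  | .tgt => { S with tgt := l }
  | .qry => { S with qry := l }
  | .lo d => { S with lo := Function.update S.lo d l }
  | .hi d => { S with hi := Function.update S.hi d l }

theorem get_set (S : Tapes c) (t : Tape c) (l : List (Option Bool)) :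
    (S.set t l).get = Function.update S.get t l := by
  funext t'
  by_cases h : t' = t
  · subst h
    cases t' <;> simp [get, set]
  · rw [Function.update_of_ne h]
    cases t <;> cases t' <;> simp_all [get, set]

theorem ext_get {S T : Tapes c} (h : ∀ t, S.get t = T.get t) : S = T := by
  cases S; cases T
  simp only [mk.injEq]
  exact ⟨h .inp, h .cur, h .cmp, h .tmp, h .tgt, h .qry, funext fun d => h (.lo d),
    funext fun d => h (.hi d)⟩

end Tapes

/-- The labels of the machine outside of its two subroutines. The bit `s` selects a subroutine, `p`
is the parity of the certificate read so far, `d` tells whether a difference between the current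
word and its successor has been found, and `r` is the result. -/
inductive Label (c : ℕ)
  | initX
  | initY
  | spread (p : Option Bool)
  | record (p : Bool)
  | copy (s p : Bool)
  | readZ (s p d : Bool)
  | readV (s p d : Bool)
  | call (s p d : Bool)
  | ret (s p d : Bool)
  | tick (p : Bool) (j : Fin (c + 1))
  | reset (p : Bool) (j : Fin c)
  | compare
  | final
  | clean (r : Bool)
  | finish (r : Bool)
  deriving Fintype

variable (M : Bool → TM2ComputableAux (Option Bool) Bool) (c : ℕ)

/-- All stacks of the machine: the output, the work tapes, the stacks of the subroutines. -/
abbrev Stack : Type := Option (Tape c ⊕ Σ s, (M s).tm.K)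

/-- The alphabets of the stacks. -/
@[reducible] def Alphabet : Stack M c → Type
  | none => Bool
  | some (.inl _) => Option Bool
  | some (.inr k) => (M k.1).tm.Γ k.2

/-- The labels of the machine; those of the subroutines remember `s`, `p` and `d`. -/
abbrev Labels : Type := Label c ⊕ Σ s, Bool × Bool × (M s).tm.Λ

/-- The two symbols that have last been read. -/
abbrev Scratch : Type := Option (Option Bool) × Option (Option Bool)

/-- The internal states of the machine. -/
abbrev State : Type := Scratch × ∀ s, (M s).tm.σ

/-- The statements of the machine. -/
abbrev Stm : Type := TM2.Stmt (Alphabet M c) (Labels M c) (State M)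

variable {M c}

/-- Pop a tape, storing the symbol in the first scratch register. -/
def pop₁ (t : Tape c) (q : Stm M c) : Stm M c :=
  .pop (some (.inl t)) (fun v o => ((o, v.1.2), v.2)) q

/-- Pop a tape, storing the symbol in the second scratch register. -/
def pop₂ (t : Tape c) (q : Stm M c) : Stm M c :=
  .pop (some (.inl t)) (fun v o => ((v.1.1, o), v.2)) q

/-- Push the symbol in the first scratch register. -/
def push₁ (t : Tape c) (q : Stm M c) : Stm M c :=
  .push (some (.inl t)) (fun v => v.1.1.getD none) q

/-- Push the symbol in the second scratch register. -/
def push₂ (t : Tape c) (q : Stm M c) : Stm M c :=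
  .push (some (.inl t)) (fun v => v.1.2.getD none) q

/-- Push the separator. -/
def pushSep (t : Tape c) (q : Stm M c) : Stm M c :=
  .push (some (.inl t)) (fun _ => none) q

/-- Continue at a label. -/
def jump (l : Label c) : Stm M c := .goto fun _ => .inl l

/-- Continue according to whether a symbol, and which, is in the first scratch register. -/
def case₁ (qempty qsep : Stm M c) (q : Bool → Stm M c) : Stm M c :=
  .branch (fun v => v.1.1 = none) qempty <| .branch (fun v => v.1.1 = some none) qsep <|
    .branch (fun v => v.1.1 = some (some true)) (q true) (q false)

/-- Pop all tapes in a list; afterwards the second scratch register is empty if they all were. -/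
def popAll : List (Tape c) → Stm M c → Stm M c
  | [], q => q
  | t :: l, q => .pop (some (.inl t)) (fun v o => ((v.1.1, v.1.2.or o), v.2)) (popAll l q)

/-- Push the symbol in the first scratch register to all digits in a list. -/
def pushDigits (l : List (Fin c)) (q : Stm M c) : Stm M c :=
  l.foldr (fun d q => push₁ (.lo d) q) q

variable (M c) in
/-- The statement that is executed at a label. In the input `x # y # u #`, the word `x` goes to the
tapes `cur` and `cmp` and to the odometer, and the reversed word `y` to `tgt`. A record of `u` consists
of a bit `s` and the blocks of two words `z` and `v`. While it is read, the query `x # z # v #` is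
collected on `qry` in reverse order, and the word `z` on `tmp`, also in reverse order; on its way to
the input stack of the subroutine `s` the query is reversed once more. If the answer is positive and
`z ≠ x`, the odometer ticks and `z` becomes the current word; if `z = x`, the certificate has to end
here, with `z` the target word. -/
noncomputable def code (p₀ : Bool) : Label c → Stm M c
  | .initX => pop₁ .inp <| case₁ (jump (.clean false)) (jump (.spread none)) fun _ =>
      push₁ .tmp <| jump .initX
  | .initY => pop₁ .inp <| case₁ (jump (.clean false)) (jump (.record p₀)) fun _ =>
      push₁ .tgt <| jump .initY
  | .spread none => pop₁ .tmp <| .branch (fun v => v.1.1 = none) (jump .initY) <|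
      push₁ .cur <| push₁ .cmp <| pushDigits (List.finRange c) <| jump (.spread none)
  | .spread (some p) => pop₁ .tmp <| .branch (fun v => v.1.1 = none) (jump (.record p)) <|
      push₁ .cur <| push₁ .cmp <| jump (.spread (some p))
  | .record p => pop₁ .inp <| case₁ (jump (.clean false)) (jump (.clean false)) fun s =>
      jump (.copy s p)
  | .copy s p => pop₁ .cur <| .branch (fun v => v.1.1 = none)
      (pushSep .qry <| jump (.readZ s p false)) <| push₁ .qry <| jump (.copy s p)
  | .readZ s p d => pop₁ .inp <| case₁ (jump (.clean false)) (jump (.clean false)) fun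
      | true => pop₂ .inp <| pop₁ .cmp <|
          .branch (fun v => v.1.1 = none || v.1.2 = some none)
            (jump (.clean false)) <|
          push₂ .tmp <| push₂ .qry <|
          .branch (fun v => v.1.1 = v.1.2) (jump (.readZ s p d)) (jump (.readZ s p true))
      | false => pop₁ .cmp <| .branch (fun v => v.1.1 = none)
          (pushSep .qry <| jump (.readV s p d)) (jump (.clean false))
  | .readV s p d => pop₁ .inp <| case₁ (jump (.clean false)) (jump (.clean false)) fun
      | true => pop₂ .inp <| .branch (fun v => v.1.2 = some none)
          (jump (.clean false)) <| push₂ .qry <| jump (.readV s p d)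
      | false => pushSep .qry <| jump (.call s p d)
  | .call s p d => pop₁ .qry <| .branch (fun v => v.1.1 = none)
      (.goto fun _ => .inr ⟨s, p, d, (M s).tm.main⟩) <|
      .push (some (.inr ⟨s, (M s).tm.k₀⟩)) (fun v => (M s).inputAlphabet.symm (v.1.1.getD none)) <|
      jump (.call s p d)
  | .ret s p d => .pop (some (.inr ⟨s, (M s).tm.k₁⟩))
      (fun v o => ((o.map fun b => some ((M s).outputAlphabet b), v.1.2), v.2)) <|
      .branch (fun v => v.1.1 = some (some true))
        (if d then jump (.tick (p ^^ s ^^ true) 0)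
          else if p = s then jump .compare else jump (.clean false))
        (jump (.clean false))
  | .tick p j => if h : j.val < c then
        pop₁ (.lo ⟨j, h⟩) <| .branch (fun v => v.1.1 = none) (jump (.reset p ⟨j, h⟩)) <|
          push₁ (.hi ⟨j, h⟩) <| jump (.spread (some p))
      else jump (.clean false)
  | .reset p j => pop₁ (.hi j) <| .branch (fun v => v.1.1 = none) (jump (.tick p j.succ)) <|
      push₁ (.lo j) <| jump (.reset p j)
  | .compare => pop₁ .tmp <| pop₂ .tgt <| .branch (fun v => v.1.1 = v.1.2)
      (.branch (fun v => v.1.1 = none) (jump .final) (jump .compare)) (jump (.clean false))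
  | .final => pop₁ .inp <| case₁ (jump (.clean false)) (jump (.clean true)) fun _ =>
      jump (.clean false)
  | .clean r => .load (fun v => ((v.1.1, none), v.2)) <|
      popAll Finset.univ.toList <|
        .branch (fun v => v.1.2 = none) (jump (.finish r)) (jump (.clean r))
  | .finish r => .push none (fun _ => r) <| .load (fun v => ((none, none), v.2)) .halt

variable (M c) in
/-- A machine that decides, with the help of deciders `M false` and `M true` for two ternary
relations, which words certify a chain. -/
noncomputable def machine (p₀ : Bool) : FinTM2 :=
  letI := fun s => (M s).tm.kFin
  letI := fun s => (M s).tm.ΛFin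
  letI := fun s => (M s).tm.σFin
  { K := Stack M c
    k₀ := some (.inl .inp)
    k₁ := none
    Γ := Alphabet M c
    Λ := Labels M c
    main := .inl .initX
    σ := State M
    initialState := ((none, none), fun s => (M s).tm.initialState)
    Γk₀Fin := inferInstanceAs (Fintype (Option Bool))
    m := fun
      | .inl l => code M c p₀ l
      | .inr ⟨s, p, d, l⟩ => TM2.Stmt.embed (Γ' := Alphabet M c)
          (fun k => some (.inr ⟨s, k⟩)) (fun v => v.2 s)
          (fun a v => (v.1, Function.update v.2 s a)) (fun l => .inr ⟨s, p, d, l⟩)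
          (.inl (.ret s p d)) ((M s).tm.m l) }

/-- The contents of all stacks while the output is empty, given the contents of the work tapes and
of the stacks of the subroutines. -/
def contents (S : Tapes c) (Q : ∀ k : Σ s, (M s).tm.K, List ((M k.1).tm.Γ k.2)) :
    ∀ k, List (Alphabet M c k)
  | none => []
  | some (.inl t) => S.get t
  | some (.inr k) => Q k

theorem contents_update_tape (S : Tapes c) (Q : ∀ k : Σ s, (M s).tm.K, List ((M k.1).tm.Γ k.2))
    (t : Tape c) (l : List (Option Bool)) :
    Function.update (contents S Q) (some (.inl t)) l = contents (S.set t l) Q := by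
  funext k
  rcases k with _ | t' | k
  · simp [contents]
  · by_cases h : t' = t
    · subst h; simp [contents, Tapes.get_set]
    · rw [Function.update_of_ne (by simpa using h)]
      simp [contents, Tapes.get_set, h]
  · simp [contents]

theorem contents_update_sub (S : Tapes c) (Q : ∀ k : Σ s, (M s).tm.K, List ((M k.1).tm.Γ k.2))
    (k : Σ s, (M s).tm.K) (l : List ((M k.1).tm.Γ k.2)) :
    Function.update (contents S Q) (some (.inr k)) l = contents S (Function.update Q k l) := by
  funext k'
  rcases k' with _ | t' | k'
  · simp [contents]
  · simp [contents]
  · by_cases h : k' = k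
    · subst h; simp [contents]
    · rw [Function.update_of_ne (by simpa using h)]
      simp [contents, h]

end ChainMachine

/-! ### Single steps and copying loops -/

namespace ChainMachine

open Turing

variable {M : Bool → TM2ComputableAux (Option Bool) Bool} {c : ℕ} {p₀ : Bool}

section StepAux

variable {S : Tapes c} {Q : ∀ k : Σ s, (M s).tm.K, List ((M k.1).tm.Γ k.2)} {v : State M}
  {q : Stm M c}

@[simp]
theorem stepAux_pop₁ (t : Tape c) : TM2.stepAux (pop₁ t q) v (contents S Q) =
    TM2.stepAux q (((S.get t).head?, v.1.2), v.2) (contents (S.set t (S.get t).tail) Q) := by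
  rw [← contents_update_tape]; rfl

@[simp]
theorem stepAux_pop₂ (t : Tape c) : TM2.stepAux (pop₂ t q) v (contents S Q) =
    TM2.stepAux q ((v.1.1, (S.get t).head?), v.2) (contents (S.set t (S.get t).tail) Q) := by
  rw [← contents_update_tape]; rfl

@[simp]
theorem stepAux_push₁ (t : Tape c) : TM2.stepAux (push₁ t q) v (contents S Q) =
    TM2.stepAux q v (contents (S.set t (v.1.1.getD none :: S.get t)) Q) := by
  rw [← contents_update_tape]; rfl

@[simp]
theorem stepAux_push₂ (t : Tape c) : TM2.stepAux (push₂ t q) v (contents S Q) =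
    TM2.stepAux q v (contents (S.set t (v.1.2.getD none :: S.get t)) Q) := by
  rw [← contents_update_tape]; rfl

@[simp]
theorem stepAux_pushSep (t : Tape c) : TM2.stepAux (pushSep t q) v (contents S Q) =
    TM2.stepAux q v (contents (S.set t (none :: S.get t)) Q) := by
  rw [← contents_update_tape]; rfl

@[simp]
theorem stepAux_jump (l : Label c) : TM2.stepAux (jump l) v (contents S Q) =
    ⟨some (.inl l), v, contents S Q⟩ := rfl

@[simp]
theorem stepAux_case₁ (q₁ q₂ : Stm M c) (q₃ : Bool → Stm M c) :
    TM2.stepAux (case₁ q₁ q₂ q₃) v (contents S Q) = match v.1.1 with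
      | none => TM2.stepAux q₁ v (contents S Q)
      | some none => TM2.stepAux q₂ v (contents S Q)
      | some (some b) => TM2.stepAux (q₃ b) v (contents S Q) := by
  obtain ⟨⟨a, b⟩, u⟩ := v
  rcases a with _ | _ | _ | _ <;> rfl

@[simp]
theorem stepAux_pushDigits {l : List (Fin c)} (hl : l.Nodup) :
    TM2.stepAux (pushDigits l q) v (contents S Q) = TM2.stepAux q v (contents
      { S with lo := fun d => if d ∈ l then v.1.1.getD none :: S.lo d else S.lo d } Q) := by
  induction l generalizing S with
  | nil => rfl
  | cons d l ih =>
    rw [List.nodup_cons] at hl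
    change TM2.stepAux (push₁ (.lo d) (pushDigits l q)) v (contents S Q) = _
    rw [stepAux_push₁, ih hl.2]
    congr 3
    funext e
    by_cases h : e = d
    · subst h; simp [hl.1, Tapes.set, Tapes.get]
    · simp [h, Tapes.set]

theorem stepAux_popAll {l : List (Tape c)} (hl : l.Nodup) :
    ∃ (S' : Tapes c) (b : Option (Option Bool)),
      (∀ t ∈ l, S'.get t = (S.get t).tail) ∧ (∀ t, t ∉ l → S'.get t = S.get t) ∧
      (b = none ↔ v.1.2 = none ∧ ∀ t ∈ l, S.get t = []) ∧
      TM2.stepAux (popAll l q) v (contents S Q) =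
        TM2.stepAux q ((v.1.1, b), v.2) (contents S' Q) := by
  induction l generalizing S v with
  | nil => exact ⟨S, v.1.2, by simp, by simp, by simp, rfl⟩
  | cons t l ih =>
    rw [List.nodup_cons] at hl
    obtain ⟨S', b, h₁, h₂, h₃, h₄⟩ := ih (S := S.set t (S.get t).tail)
      (v := ((v.1.1, v.1.2.or (S.get t).head?), v.2)) hl.2
    simp only [Tapes.get_set] at h₁ h₂ h₃
    refine ⟨S', b, ?_, ?_, ?_, ?_⟩
    · intro t' ht'
      rcases List.mem_cons.1 ht' with rfl | ht'
      · rw [h₂ _ hl.1]; simp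
      · rw [h₁ _ ht', Function.update_of_ne (ne_of_mem_of_not_mem ht' hl.1)]
    · intro t' ht'
      rw [List.mem_cons, not_or] at ht'
      rw [h₂ _ ht'.2, Function.update_of_ne ht'.1]
    · rw [h₃, Option.or_eq_none_iff, List.head?_eq_none_iff, List.forall_mem_cons, and_assoc]
      refine and_congr_right fun _ => and_congr_right fun _ => forall₂_congr fun t' ht' => ?_
      rw [Function.update_of_ne (ne_of_mem_of_not_mem ht' hl.1)]
    · rw [← contents_update_tape] at h₄
      exact h₄

end StepAux

variable (M) in
/-- The contents of the stacks of the subroutines between calls. -/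
def noSub : ∀ k : Σ s, (M s).tm.K, List ((M k.1).tm.Γ k.2) := fun _ => []

variable (M) in
/-- The configuration at the label `l` in which the subroutines are not active. -/
def conf (l : Label c) (w : Scratch) (S : Tapes c)
    (Q : ∀ k : Σ s, (M s).tm.K, List ((M k.1).tm.Γ k.2)) :
    TM2.Cfg (Alphabet M c) (Labels M c) (State M) :=
  ⟨some (.inl l), (w, fun s => (M s).tm.initialState), contents S Q⟩

variable (M p₀) in
/-- Starting at the label `l` with tapes `S`, the machine arrives within `n` steps at the label `l'`
with tapes `S'`, whatever the symbols in the scratch registers. -/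
def GoesTo (n : ℕ) (l : Label c) (S : Tapes c) (l' : Label c) (S' : Tapes c) : Prop :=
  ∀ w, ∃ w', ∃ m ≤ n,
    ReachIn (machine M c p₀).step m (conf M l w S (noSub M)) (conf M l' w' S' (noSub M))

namespace GoesTo

variable {l l' l'' : Label c} {S S' S'' : Tapes c} {m n : ℕ}

theorem mono (h : GoesTo M p₀ m l S l' S') (hmn : m ≤ n) : GoesTo M p₀ n l S l' S' := fun w =>
  let ⟨w', k, hk, h⟩ := h w
  ⟨w', k, hk.trans hmn, h⟩

theorem trans (h₁ : GoesTo M p₀ m l S l' S') (h₂ : GoesTo M p₀ n l' S' l'' S'') :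
    GoesTo M p₀ (m + n) l S l'' S'' := fun w => by
  obtain ⟨w', k, hk, h⟩ := h₁ w
  obtain ⟨w'', k', hk', h'⟩ := h₂ w'
  exact ⟨w'', k + k', Nat.add_le_add hk hk', h.trans h'⟩

theorem of_step (h : ∀ w : Scratch, ∃ w', TM2.stepAux (code M c p₀ l)
    (w, fun s => (M s).tm.initialState) (contents S (noSub M)) = conf M l' w' S' (noSub M)) :
    GoesTo M p₀ 1 l S l' S' := fun w =>
  let ⟨w', h⟩ := h w
  ⟨w', 1, le_rfl, _, rfl, h⟩

/-- One step followed by a run. -/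
theorem cons (h : ∀ w : Scratch, ∃ w', TM2.stepAux (code M c p₀ l)
    (w, fun s => (M s).tm.initialState) (contents S (noSub M)) = conf M l' w' S' (noSub M))
    (h₂ : GoesTo M p₀ n l' S' l'' S'') : GoesTo M p₀ (n + 1) l S l'' S'' :=
  ((of_step h).trans h₂).mono (Nat.add_comm _ _).le

end GoesTo

section Loops

variable {i x x₂ t y q : List (Option Bool)} {lo hi : Fin c → List (Option Bool)}

theorem initX_run (u : Word) (r : List (Option Bool)) :
    GoesTo M p₀ (u.length + 1) .initX ⟨u.map some ++ none :: r, x, x₂, t, y, q, lo, hi⟩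
      (.spread none) ⟨r, x, x₂, (u.map some).reverse ++ t, y, q, lo, hi⟩ := by
  induction u generalizing t with
  | nil => exact .of_step fun w => by simp [code, conf, Tapes.get, Tapes.set]
  | cons b u ih =>
    have := ih (t := some b :: t)
    refine .cons (fun w => ?_) (by simpa using this)
    simp [code, conf, Tapes.get, Tapes.set]

theorem initY_run (u : Word) (r : List (Option Bool)) :
    GoesTo M p₀ (u.length + 1) .initY ⟨u.map some ++ none :: r, x, x₂, t, y, q, lo, hi⟩
      (.record p₀) ⟨r, x, x₂, t, (u.map some).reverse ++ y, q, lo, hi⟩ := by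
  induction u generalizing y with
  | nil => exact .of_step fun w => by simp [code, conf, Tapes.get, Tapes.set]
  | cons b u ih =>
    have := ih (y := some b :: y)
    refine .cons (fun w => ?_) (by simpa using this)
    simp [code, conf, Tapes.get, Tapes.set]

/-- The first time, the scratch tape is also copied to all digits of the odometer. -/
theorem spread_none_run (u : List (Option Bool)) :
    GoesTo M p₀ (u.length + 1) (.spread none) ⟨i, x, x₂, u, y, q, lo, hi⟩
      .initY ⟨i, u.reverse ++ x, u.reverse ++ x₂, [], y, q, fun d => u.reverse ++ lo d, hi⟩ := by
  induction u generalizing x x₂ lo with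
  | nil => exact .of_step fun w => by simp [code, conf, Tapes.get, Tapes.set]
  | cons b u ih =>
    have := ih (x := b :: x) (x₂ := b :: x₂) (lo := fun d => b :: lo d)
    refine .cons (fun w => ?_) (by simpa using this)
    simp [code, conf, Tapes.get, Tapes.set, List.nodup_finRange]

theorem spread_some_run (p : Bool) (u : List (Option Bool)) :
    GoesTo M p₀ (u.length + 1) (.spread (some p)) ⟨i, x, x₂, u, y, q, lo, hi⟩
      (.record p) ⟨i, u.reverse ++ x, u.reverse ++ x₂, [], y, q, lo, hi⟩ := by
  induction u generalizing x x₂ with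
  | nil => exact .of_step fun w => by simp [code, conf, Tapes.get, Tapes.set]
  | cons b u ih =>
    have := ih (x := b :: x) (x₂ := b :: x₂)
    refine .cons (fun w => ?_) (by simpa using this)
    simp [code, conf, Tapes.get, Tapes.set]

theorem copy_run (s p : Bool) (u : List (Option Bool)) :
    GoesTo M p₀ (u.length + 1) (.copy s p) ⟨i, u, x₂, t, y, q, lo, hi⟩
      (.readZ s p false) ⟨i, [], x₂, t, y, none :: (u.reverse ++ q), lo, hi⟩ := by
  induction u generalizing q with
  | nil => exact .of_step fun w => by simp [code, conf, Tapes.get, Tapes.set]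
  | cons b u ih =>
    have := ih (q := b :: q)
    refine .cons (fun w => ?_) (by simpa using this)
    simp [code, conf, Tapes.get, Tapes.set]

end Loops

end ChainMachine

/-! ### Reading blocks, comparing, counting and cleaning up -/

/-- A self-delimiting code of a word: each letter is preceded by `1`, and `0` marks the end. -/
def blockCode : Word → Word
  | [] => [false]
  | b :: w => true :: b :: blockCode w

theorem blockCode_append_inj {w w' r r' : Word} (h : blockCode w ++ r = blockCode w' ++ r') :
    w = w' ∧ r = r' := by
  induction w generalizing w' with
  | nil => cases w' <;> simp_all [blockCode]
  | cons b w ih =>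
    cases w' with
    | nil => simp [blockCode] at h
    | cons b' w' =>
      simp only [blockCode, List.cons_append, List.cons.injEq, true_and] at h
      obtain ⟨rfl, h⟩ := h
      simpa using ih h

theorem length_blockCode (w : Word) : (blockCode w).length = 2 * w.length + 1 := by
  induction w with
  | nil => rfl
  | cons b w ih => simp only [blockCode, List.length_cons, ih]; ring

/-- Induction along the attempt to split off a block from a word: it ends at an end mark, or at the
end of the word. -/
theorem blockInduction {P : Word → Prop} (nil : P []) (mark : ∀ r, P (false :: r))
    (single : P [true]) (step : ∀ b r, P r → P (true :: b :: r)) : ∀ u, P u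
  | [] => nil
  | false :: r => mark r
  | [true] => single
  | true :: b :: r => step b r (blockInduction nil mark single step r)

namespace ChainMachine

open Turing

variable {M : Bool → TM2ComputableAux (Option Bool) Bool} {c : ℕ} {p₀ : Bool}

variable (M p₀) in
/-- Starting at the label `l` with tapes `S`, the machine arrives within `n` steps at the point where
it has settled on the answer `r`. -/
def Answers (n : ℕ) (l : Label c) (S : Tapes c) (r : Bool) : Prop :=
  ∃ S', GoesTo M p₀ n l S (.clean r) S'

namespace Answers

variable {l l' : Label c} {S S' : Tapes c} {m n : ℕ} {r : Bool}

theorem mono (h : Answers M p₀ m l S r) (hmn : m ≤ n) : Answers M p₀ n l S r :=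
  let ⟨S', h⟩ := h
  ⟨S', h.mono hmn⟩

theorem of_goesTo (h₁ : GoesTo M p₀ m l S l' S') (h₂ : Answers M p₀ n l' S' r) :
    Answers M p₀ (m + n) l S r :=
  let ⟨S'', h⟩ := h₂
  ⟨S'', h₁.trans h⟩

end Answers

section Reading

variable {i x x₂ t y q : List (Option Bool)} {lo hi : Fin c → List (Option Bool)} {s p d : Bool}

/-- A word `z` of the right length is copied to the scratch tape and to the query, and compared with
the current word on the way. -/
theorem readZ_run (z w r : Word) (h : z.length = w.length) :
    GoesTo M p₀ (z.length + 1)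
      (.readZ s p d) ⟨(blockCode z ++ r).map some ++ i, x, w.map some, t, y, q, lo, hi⟩
      (.readV s p (d || decide (z ≠ w)))
      ⟨r.map some ++ i, x, [], (z.map some).reverse ++ t, y, none :: ((z.map some).reverse ++ q),
        lo, hi⟩ := by
  induction z generalizing w t q d with
  | nil =>
    obtain rfl : w = [] := List.length_eq_zero_iff.1 h.symm
    exact .of_step fun w => by simp [code, conf, Tapes.get, Tapes.set, blockCode]
  | cons b z ih =>
    obtain _ | ⟨b', w⟩ := w
    · simp at h
    have := ih (t := some b :: t) (q := some b :: q) (d := d || decide (b ≠ b')) w (by simpa using h)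
    refine .cons (fun w => ?_) (S' := ⟨(blockCode z ++ r).map some ++ i, x, w.map some,
      some b :: t, y, some b :: q, lo, hi⟩) (l' := .readZ s p (d || decide (b ≠ b'))) ?_
    · by_cases hb : b' = b
      · simp [code, conf, Tapes.get, Tapes.set, blockCode, hb]
      · simp [code, conf, Tapes.get, Tapes.set, blockCode, hb, Ne.symm hb]
    · simpa [Bool.or_assoc] using this

theorem readZ_reject (u w : Word) (h : ∀ z r, u = blockCode z ++ r → z.length ≠ w.length) :
    Answers M p₀ (u.length + 1) (.readZ s p d)
      ⟨u.map some ++ none :: i, x, w.map some, t, y, q, lo, hi⟩ false := by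
  induction u using blockInduction generalizing w t q d with
  | nil => exact ⟨_, .of_step fun w => by simp [code, conf, Tapes.get, Tapes.set]; rfl⟩
  | mark r =>
    obtain _ | ⟨b', w⟩ := w
    · exact absurd rfl (h [] r rfl)
    · exact ⟨_, .mono (.of_step fun w => by simp [code, conf, Tapes.get, Tapes.set]; rfl)
        (by simp)⟩
  | single =>
    exact ⟨_, .mono (.of_step fun w => by simp [code, conf, Tapes.get, Tapes.set]; rfl) (by simp)⟩
  | step b r ih =>
    obtain _ | ⟨b', w⟩ := w
    · exact ⟨_, .mono (.of_step fun w => by simp [code, conf, Tapes.get, Tapes.set]; rfl)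
        (by simp)⟩
    obtain ⟨S', hS⟩ := ih (t := some b :: t) (q := some b :: q) (d := d || decide (b ≠ b')) w
      (fun z r' hz hl => h (b :: z) r' (by simp [hz, blockCode]) (by simp [hl]))
    refine ⟨S', .mono (.cons (fun w => ?_) hS) (by simp)⟩
    by_cases hb : b' = b
    · simp [code, conf, Tapes.get, Tapes.set, hb]
    · simp [code, conf, Tapes.get, Tapes.set, hb, Ne.symm hb]

theorem readV_run (v r : Word) :
    GoesTo M p₀ (v.length + 1)
      (.readV s p d) ⟨(blockCode v ++ r).map some ++ i, x, x₂, t, y, q, lo, hi⟩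
      (.call s p d)
      ⟨r.map some ++ i, x, x₂, t, y, none :: ((v.map some).reverse ++ q), lo, hi⟩ := by
  induction v generalizing q with
  | nil => exact .of_step fun w => by simp [code, conf, Tapes.get, Tapes.set, blockCode]
  | cons b v ih =>
    have := ih (q := some b :: q)
    refine .cons (fun w => ?_) (by simpa using this)
    simp [code, conf, Tapes.get, Tapes.set, blockCode]

theorem readV_reject (u : Word) (h : ∀ v r, u ≠ blockCode v ++ r) :
    Answers M p₀ (u.length + 1) (.readV s p d)
      ⟨u.map some ++ none :: i, x, x₂, t, y, q, lo, hi⟩ false := by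
  induction u using blockInduction generalizing q with
  | nil => exact ⟨_, .of_step fun w => by simp [code, conf, Tapes.get, Tapes.set]; rfl⟩
  | mark r => exact absurd rfl (h [] r)
  | single =>
    exact ⟨_, .mono (.of_step fun w => by simp [code, conf, Tapes.get, Tapes.set]; rfl) (by simp)⟩
  | step b r ih =>
    obtain ⟨S', hS⟩ := ih (q := some b :: q) (fun v r' hv => h (b :: v) r' (by simp [hv, blockCode]))
    refine ⟨S', .mono (.cons (fun w => ?_) hS) (by simp)⟩
    simp [code, conf, Tapes.get, Tapes.set]

theorem compare_run (a : List (Option Bool)) :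
    GoesTo M p₀ (a.length + 1) (.compare) ⟨i, x, x₂, a, a, q, lo, hi⟩
      .final ⟨i, x, x₂, [], [], q, lo, hi⟩ := by
  induction a with
  | nil => exact .of_step fun w => by simp [code, conf, Tapes.get, Tapes.set]
  | cons b a ih =>
    refine .cons (fun w => ?_) ih
    simp [code, conf, Tapes.get, Tapes.set]

theorem compare_reject (a b : List (Option Bool)) (h : a ≠ b) :
    Answers M p₀ (a.length + 1) (.compare) ⟨i, x, x₂, a, b, q, lo, hi⟩ false := by
  induction a generalizing b with
  | nil =>
    obtain _ | ⟨e, b⟩ := b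
    · exact absurd rfl h
    · exact ⟨_, .of_step fun w => by simp [code, conf, Tapes.get, Tapes.set]; rfl⟩
  | cons e a ih =>
    obtain _ | ⟨e', b⟩ := b
    · exact ⟨_, .mono (.of_step fun w => by simp [code, conf, Tapes.get, Tapes.set]; rfl)
        (by simp)⟩
    by_cases he : e = e'
    · subst he
      obtain ⟨S', hS⟩ := ih b (by simpa using h)
      refine ⟨S', .cons (fun w => ?_) hS⟩
      simp [code, conf, Tapes.get, Tapes.set]
    · exact ⟨_, .mono (.of_step fun w => by simp [code, conf, Tapes.get, Tapes.set, he]; rfl)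
        (by simp)⟩

theorem final_run (r : Word) :
    Answers M p₀ 1 .final ⟨r.map some ++ none :: i, x, x₂, t, y, q, lo, hi⟩ (decide (r = [])) := by
  obtain _ | ⟨b, r⟩ := r
  · exact ⟨_, .of_step fun w => by simp [code, conf, Tapes.get, Tapes.set]; rfl⟩
  · exact ⟨_, .of_step fun w => by simp [code, conf, Tapes.get, Tapes.set]; rfl⟩

end Reading

section Odometer

variable {i x x₂ t y q : List (Option Bool)} {lo hi : Fin c → List (Option Bool)}

/-- The value of the odometer in base `n + 1`. -/
def odometer (n : ℕ) (lo : Fin c → List (Option Bool)) : ℕ :=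
  ∑ d, (lo d).length * (n + 1) ^ d.val

theorem odometer_update (n : ℕ) (lo : Fin c → List (Option Bool)) (d : Fin c)
    (l : List (Option Bool)) :
    odometer n (Function.update lo d l) + (lo d).length * (n + 1) ^ d.val =
      odometer n lo + l.length * (n + 1) ^ d.val := by
  unfold odometer
  rw [← Finset.add_sum_erase _ _ (Finset.mem_univ d),
    ← Finset.add_sum_erase (a := d) Finset.univ (fun d => (lo d).length * (n + 1) ^ d.val)
      (Finset.mem_univ d),
    Finset.sum_congr rfl (g := fun d => (lo d).length * (n + 1) ^ d.val)]
  · rw [Function.update_self]; ring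
  · intro e he
    rw [Function.update_of_ne (Finset.ne_of_mem_erase he)]

theorem odometer_full {n : ℕ} (h : ∀ d, (lo d).length = n) : odometer n lo + 1 = (n + 1) ^ c := by
  unfold odometer
  simp only [h]
  induction c with
  | zero => simp
  | succ c ih =>
    have := ih (lo := fun d => lo d.castSucc) (fun d => h _)
    rw [Fin.sum_univ_castSucc, pow_succ, ← this]
    simp only [Fin.val_castSucc, Fin.val_last]
    rw [← this]
    ring

theorem reset_run (p : Bool) (j : Fin c) (l : List (Option Bool)) :
    GoesTo M p₀ (l.length + 1) (.reset p j)
      ⟨i, x, x₂, t, y, q, lo, Function.update hi j l⟩ (.tick p j.succ)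
      ⟨i, x, x₂, t, y, q, Function.update lo j (l.reverse ++ lo j), Function.update hi j []⟩ := by
  induction l generalizing lo with
  | nil => exact .of_step fun w => by simp [code, conf, Tapes.get, Tapes.set]
  | cons b l ih =>
    have := ih (lo := Function.update lo j (b :: lo j))
    refine .cons (fun w => ?_) (by simpa using this)
    simp [code, conf, Tapes.get, Tapes.set]

/-- A tick lowers the odometer by one, or leads to rejection if it has value `0`. In general the
digits below the `j`-th one have already been reset from `0` to `n`. -/
theorem tick_run {n v : ℕ} {p : Bool} (j : Fin (c + 1)) (hn : ∀ d, (lo d).length + (hi d).length = n)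
    (hj : ∀ d : Fin c, d.val < j.val → (lo d).length = n)
    (hv : odometer n lo + 1 = v + (n + 1) ^ j.val) :
    (v = 0 ∧ Answers M p₀ ((c - j) * (n + 2) + 1) (.tick p j)
      ⟨i, x, x₂, t, y, q, lo, hi⟩ false) ∨
    ∃ lo' hi', (∀ d, (lo' d).length + (hi' d).length = n) ∧ odometer n lo' + 1 = v ∧
      GoesTo M p₀ ((c - j) * (n + 2) + 1) (.tick p j) ⟨i, x, x₂, t, y, q, lo, hi⟩
        (.spread (some p)) ⟨i, x, x₂, t, y, q, lo', hi'⟩ := by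
  induction j using Fin.reverseInduction generalizing lo hi with
  | last =>
    refine .inl ⟨?_, ?_⟩
    · rw [odometer_full fun d => hj d d.2] at hv
      simpa using hv
    · exact ⟨_, .mono (.of_step fun w => by simp [code, conf]; rfl) (by simp)⟩
  | cast j ih =>
    simp only [Fin.val_castSucc] at hj hv ⊢
    have hcj : c - j.val = (c - j.succ.val) + 1 := by
      have := j.2; simp only [Fin.val_succ]; omega
    rcases hlo : lo j with _ | ⟨b, l⟩
    · have hhi : (hi j).length = n := by simpa [hlo] using hn j
      have hodo := odometer_update n lo j ((hi j).reverse ++ lo j)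
      have h₁ : GoesTo M p₀ (1 + (n + 1)) (.tick p j.castSucc) ⟨i, x, x₂, t, y, q, lo, hi⟩
          (.tick p j.succ) ⟨i, x, x₂, t, y, q, Function.update lo j ((hi j).reverse ++ lo j),
            Function.update hi j []⟩ := by
        refine .trans (l' := .reset p j) (S' := ⟨i, x, x₂, t, y, q, lo, hi⟩)
          (.of_step fun w => by
            have hlo' : Function.update lo j [] = lo := by rw [← hlo, Function.update_eq_self]
            simp [code, conf, Tapes.get, Tapes.set, hlo, hlo']) ?_
        have := reset_run (M := M) (p₀ := p₀) (i := i) (x := x) (x₂ := x₂) (t := t) (y := y) (q := q)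
          (lo := lo) (hi := hi) p j (hi j)
        rwa [Function.update_eq_self, hhi] at this
      have h₂ := ih (lo := Function.update lo j ((hi j).reverse ++ lo j))
        (hi := Function.update hi j []) ?_ ?_ ?_
      · rcases h₂ with ⟨hv0, h₂⟩ | ⟨lo', hi', hn', hv', h₂⟩
        · refine .inl ⟨hv0, (Answers.of_goesTo h₁ h₂).mono ?_⟩
          rw [hcj]; ring_nf; omega
        · refine .inr ⟨lo', hi', hn', hv', (h₁.trans h₂).mono ?_⟩
          rw [hcj]; ring_nf; omega
      · intro d
        by_cases hd : d = j
        · subst hd; simp [hlo, hhi]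
        · simpa [hd] using hn d
      · intro d hd
        by_cases hdj : d = j
        · subst hdj; simp [hlo, hhi]
        · rw [Function.update_of_ne hdj]
          refine hj d ?_
          have : d.val ≠ j.val := fun h => hdj (Fin.ext h)
          simp only [Fin.val_succ] at hd
          omega
      · simp only [hlo, List.length_nil, zero_mul, add_zero, List.append_nil, List.length_reverse,
          hhi] at hodo
        rw [hlo, List.append_nil, hodo, Fin.val_succ, pow_succ]
        linarith
    · refine .inr ⟨Function.update lo j l, Function.update hi j (b :: hi j), ?_, ?_, ?_⟩
      · intro d
        by_cases hd : d = j
        · subst hd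
          have := hn d
          simp only [hlo, List.length_cons, Function.update_self] at this ⊢
          omega
        · simpa [hd] using hn d
      · have := odometer_update n lo j l
        simp only [hlo, List.length_cons, Nat.succ_mul] at this
        omega
      · refine .mono (.of_step fun w => ?_) (Nat.le_add_left _ _)
        simp [code, conf, Tapes.get, Tapes.set, hlo]

end Odometer

section Cleaning

/-- Tapes without any content. -/
def Tapes.empty : Tapes c := ⟨[], [], [], [], [], [], fun _ => [], fun _ => []⟩

/-- All tapes are emptied; a last round finds that they are empty. -/
theorem clean_run (n : ℕ) (r : Bool) (S : Tapes c) (h : ∀ t, (S.get t).length ≤ n) :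
    GoesTo M p₀ (n + 1) (.clean r) S (.finish r) .empty := by
  induction n generalizing S with
  | zero =>
    refine .of_step fun w => ?_
    obtain ⟨S', b, h₁, -, h₃, h₄⟩ := stepAux_popAll (M := M) (S := S) (Q := noSub M)
      (v := ((w.1, none), fun s => (M s).tm.initialState))
      (q := .branch (fun v => v.1.2 = none) (jump (.finish r)) (jump (.clean r)))
      (Finset.nodup_toList (Finset.univ : Finset (Tape c)))
    have hS : ∀ t, S.get t = [] := fun t => List.length_eq_zero_iff.1 (Nat.le_zero.1 (h t))
    obtain rfl : S' = .empty := Tapes.ext_get fun t => by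
      rw [h₁ t (by simp), hS]; cases t <;> rfl
    obtain rfl : b = none := h₃.2 ⟨rfl, fun t _ => hS t⟩
    exact ⟨(w.1, none), h₄⟩
  | succ n ih =>
    intro w
    obtain ⟨S', b, h₁, -, h₃, h₄⟩ := stepAux_popAll (M := M) (S := S) (Q := noSub M)
      (v := ((w.1, none), fun s => (M s).tm.initialState))
      (q := .branch (fun v => v.1.2 = none) (jump (.finish r)) (jump (.clean r)))
      (Finset.nodup_toList (Finset.univ : Finset (Tape c)))
    by_cases hb : b = none
    · have hS := (h₃.1 hb).2
      obtain rfl : S' = .empty := Tapes.ext_get fun t => by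
        rw [h₁ t (by simp), hS t (by simp)]; cases t <;> rfl
      subst hb
      exact ⟨(w.1, none), 1, by omega, _, rfl, h₄⟩
    · obtain ⟨w', m, hm, hr⟩ := ih S' (fun t => by
        have := h t
        rw [h₁ t (by simp), List.length_tail]; omega) (w.1, b)
      refine ⟨w', m + 1, by omega, _, rfl, ?_⟩
      have h₅ : TM2.stepAux (code M c p₀ (.clean r)) (w, fun s => (M s).tm.initialState)
          (contents S (noSub M)) = conf M (.clean r) (w.1, b) S' (noSub M) := by
        refine h₄.trans ?_
        simp [hb, conf]
      exact (congrArg (fun a => ReachIn (machine M c p₀).step m a _) h₅).mpr hr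

end Cleaning

end ChainMachine

/-! ### Calling a subroutine -/

/-- The initial configuration has the input on the input stack, and nothing else. -/
theorem Turing.stk_initList (tm : FinTM2) (s : List (tm.Γ tm.k₀)) :
    (initList tm s).stk = Function.update (fun _ => []) tm.k₀ s := by
  funext k
  by_cases h : k = tm.k₀
  · subst h; simp [initList]
  · simp [initList, h]

/-- The final configuration has the output on the output stack, and nothing else. -/
theorem Turing.stk_haltList (tm : FinTM2) (s : List (tm.Γ tm.k₁)) :
    (haltList tm s).stk = Function.update (fun _ => []) tm.k₁ s := by
  funext k
  by_cases h : k = tm.k₁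
  · subst h; simp [haltList]
  · simp [haltList, h]

namespace ChainMachine

open Turing

variable {M : Bool → TM2ComputableAux (Option Bool) Bool} {c : ℕ} {p₀ : Bool}

section Call

variable {i x x₂ t y q : List (Option Bool)} {lo hi : Fin c → List (Option Bool)} {s p d : Bool}

variable (M) in
/-- The contents of the stacks of the subroutines when only the stack `k` is in use. -/
def oneSub (k : Σ s, (M s).tm.K) (l : List ((M k.1).tm.Γ k.2)) :
    ∀ k : Σ s, (M s).tm.K, List ((M k.1).tm.Γ k.2) :=
  Function.update (noSub M) k l

/-- The query is moved to the input stack of the subroutine, on top of the symbols `b` that are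
already there. -/
theorem fill_run (a b : List (Option Bool)) (w : Scratch) :
    ∃ w' : Scratch, ReachIn (machine M c p₀).step (a.length + 1)
      (conf M (.call s p d) w ⟨i, x, x₂, t, y, a, lo, hi⟩
        (oneSub M ⟨s, (M s).tm.k₀⟩ (b.map (M s).inputAlphabet.symm)))
      ⟨some (.inr ⟨s, p, d, (M s).tm.main⟩), (w', fun s => (M s).tm.initialState),
        contents ⟨i, x, x₂, t, y, [], lo, hi⟩
          (oneSub M ⟨s, (M s).tm.k₀⟩ ((a.reverse ++ b).map (M s).inputAlphabet.symm))⟩ := by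
  induction a generalizing b w with
  | nil =>
    refine ⟨(none, w.2), _, rfl, ?_⟩
    change TM2.stepAux (code M c p₀ (.call s p d)) _ (contents _ _) = _
    simp only [code, stepAux_pop₁, TM2.stepAux, Tapes.get, Tapes.set]
    rfl
  | cons e a ih =>
    obtain ⟨w', h⟩ := ih (e :: b) (some e, w.2)
    refine ⟨w', _, rfl, ?_⟩
    have h₁ : TM2.stepAux (code M c p₀ (.call s p d)) (w, fun s => (M s).tm.initialState)
        (contents ⟨i, x, x₂, t, y, e :: a, lo, hi⟩
          (oneSub M ⟨s, (M s).tm.k₀⟩ (b.map (M s).inputAlphabet.symm))) =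
        conf M (.call s p d) (some e, w.2) ⟨i, x, x₂, t, y, a, lo, hi⟩
          (oneSub M ⟨s, (M s).tm.k₀⟩ ((e :: b).map (M s).inputAlphabet.symm)) := by
      simp only [code, stepAux_pop₁, TM2.stepAux, Tapes.get, Tapes.set, List.head?_cons,
        List.tail_cons, contents_update_sub]
      simp [oneSub, contents, conf]
    rw [List.reverse_cons, List.append_assoc]
    exact (congrArg (fun z => ReachIn (machine M c p₀).step _ z _) h₁).mpr h

/-- A subroutine, started on an input that it accepts or rejects, is left with empty stacks except
for its output. -/
theorem sub_run {n : ℕ} {l : List ((M s).tm.Γ (M s).tm.k₀)} {o : List ((M s).tm.Γ (M s).tm.k₁)}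
    (h : TM2OutputsInTime (M s).tm l (some o) n) (w : Scratch) (S : Tapes c) :
    ∃ m ≤ n, ReachIn (machine M c p₀).step m
      ⟨some (.inr ⟨s, p, d, (M s).tm.main⟩), (w, fun s => (M s).tm.initialState),
        contents S (oneSub M ⟨s, (M s).tm.k₀⟩ l)⟩
      (conf M (.ret s p d) w S (oneSub M ⟨s, (M s).tm.k₁⟩ o)) := by
  refine ⟨h.steps, h.steps_le_m, ?_⟩
  have hr : ReachIn (M s).tm.step h.steps (initList (M s).tm l) (haltList (M s).tm o) :=
    ReachIn.iff_iterate.2 h.evals_in_steps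
  have hone : ∀ (k j : (M s).tm.K) (l : List ((M s).tm.Γ k)),
      oneSub M ⟨s, k⟩ l ⟨s, j⟩ = Function.update (fun _ => []) k l j := by
    intro k j l
    by_cases hj : j = k
    · subst hj; simp [oneSub]
    · simp [oneSub, hj, noSub]
  have hframe : ∀ (k : (M s).tm.K) (l : List ((M s).tm.Γ k)) (k' : Stack M c),
      k' ∉ Set.range (fun k : (M s).tm.K => (some (.inr ⟨s, k⟩) : Stack M c)) →
      contents S (oneSub M ⟨s, k⟩ l) k' = contents S (noSub M) k' := by
    rintro k l (_ | _ | k') hk'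
    · rfl
    · rfl
    · have : k' ≠ ⟨s, k⟩ := by rintro rfl; exact hk' ⟨k, rfl⟩
      simp [contents, oneSub, this]
  have hrep := TM2.Represents.reachIn (Γ' := Alphabet M c)
    (ι := fun k : (M s).tm.K => (some (.inr ⟨s, k⟩) : Stack M c))
    (get := fun v : State M => v.2 s) (set := fun a v => (v.1, Function.update v.2 s a))
    (lab := fun l => (.inr ⟨s, p, d, l⟩ : Labels M c)) (ret := .inl (.ret s p d))
    (v₀ := (w, fun s => (M s).tm.initialState)) (S₀ := contents S (noSub M))
    (m := (M s).tm.m) (m' := (machine M c p₀).m)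
    (a := initList (M s).tm l) (b := haltList (M s).tm o)
    (a' := ⟨some (.inr ⟨s, p, d, (M s).tm.main⟩), (w, fun s => (M s).tm.initialState),
        contents S (oneSub M ⟨s, (M s).tm.k₀⟩ l)⟩)
    (fun a b hab => by simpa using hab) (fun a v => by simp) (fun a b v => by simp)
    (fun l => rfl) ?_ hr
  · obtain ⟨⟨l', v', S'⟩, ⟨h₁, h₂, h₃, h₄⟩, hb'⟩ := hrep
    suffices hc : conf M (.ret s p d) w S (oneSub M ⟨s, (M s).tm.k₁⟩ o) = ⟨l', v', S'⟩ from
      (congrArg (ReachIn (machine M c p₀).step h.steps _) hc).mpr hb'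
    refine (TM2.Cfg.mk.injEq ..).mpr ⟨?_, ?_, ?_⟩
    · exact h₁.symm
    · refine Eq.trans ?_ h₂.symm
      simp [haltList]
    · funext k'
      by_cases hk : k' ∈ Set.range (fun k : (M s).tm.K => (some (.inr ⟨s, k⟩) : Stack M c))
      · obtain ⟨k, rfl⟩ := hk
        refine Eq.trans ?_ (h₃ k).symm
        rw [stk_haltList]
        exact hone _ _ _
      · exact (hframe _ _ _ hk).trans (h₄ _ hk).symm
  · refine ⟨rfl, by simp [initList], fun k => ?_, hframe _ _⟩
    rw [stk_initList]
    exact hone _ _ _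

/-- The label at which the machine continues after a call with the answer `b`. -/
def afterCall (s p d b : Bool) : Label c :=
  if b then if d then .tick (p ^^ s ^^ true) 0 else if p = s then .compare else .clean false
  else .clean false

theorem ret_run (b : Bool) (w : Scratch) (S : Tapes c) :
    ∃ w', ReachIn (machine M c p₀).step 1
      (conf M (.ret s p d) w S (oneSub M ⟨s, (M s).tm.k₁⟩ [(M s).outputAlphabet.symm b]))
      (conf M (afterCall s p d b) w' S (noSub M)) := by
  refine ⟨(some (some b), w.2), _, rfl, ?_⟩
  change TM2.stepAux (code M c p₀ (.ret s p d)) _ (contents _ _) = _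
  simp only [code, TM2.stepAux, contents_update_sub]
  have h₁ : Function.update (oneSub M ⟨s, (M s).tm.k₁⟩ [(M s).outputAlphabet.symm b])
      ⟨s, (M s).tm.k₁⟩ [] = noSub M := by
    rw [oneSub, Function.update_idem]
    exact Function.update_eq_self _ _
  have h₂ : contents S (oneSub M ⟨s, (M s).tm.k₁⟩ [(M s).outputAlphabet.symm b])
      (some (.inr ⟨s, (M s).tm.k₁⟩)) = [(M s).outputAlphabet.symm b] := by
    simp [contents, oneSub]
  rw [h₂]
  simp only [List.head?_cons, List.tail_cons, h₁, Option.map_some, Equiv.apply_symm_apply]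
  cases b
  · simp [afterCall, conf]
  · cases d
    · by_cases hps : p = s <;> simp [afterCall, conf, hps]
    · simp [afterCall, conf]

theorem call_run {a : List (Option Bool)} {b : Bool} {n : ℕ}
    (h : TM2OutputsInTime (M s).tm (a.map (M s).inputAlphabet.symm)
      (some [(M s).outputAlphabet.symm b]) n) :
    GoesTo M p₀ (a.length + n + 2) (.call s p d) ⟨i, x, x₂, t, y, a.reverse, lo, hi⟩
      (afterCall s p d b) ⟨i, x, x₂, t, y, [], lo, hi⟩ := by
  intro w
  obtain ⟨w₁, h₁⟩ := fill_run (M := M) (p₀ := p₀) (i := i) (x := x) (x₂ := x₂) (t := t) (y := y)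
    (lo := lo) (hi := hi) (s := s) (p := p) (d := d) a.reverse [] w
  have hno : oneSub M ⟨s, (M s).tm.k₀⟩ (List.map (M s).inputAlphabet.symm []) = noSub M :=
    Function.update_eq_self _ _
  rw [hno, List.reverse_reverse, List.append_nil, List.length_reverse] at h₁
  obtain ⟨m, hm, h₂⟩ := sub_run (p₀ := p₀) (p := p) (d := d) h w₁ ⟨i, x, x₂, t, y, [], lo, hi⟩
  obtain ⟨w₃, h₃⟩ := ret_run (M := M) (p₀ := p₀) (s := s) (p := p) (d := d) b w₁
    ⟨i, x, x₂, t, y, [], lo, hi⟩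
  exact ⟨w₃, _, by omega, (h₁.trans h₂).trans h₃⟩

end Call

end ChainMachine

/-! ### Certificates, and the reading of one record -/

/-- `Certifies B y k p x u` means that the word `u` describes a sequence
`x = x₀, x₁, …, x_l, x_(l+1) = x_l = y` of words of the same length, with `l ≤ k` and `xᵢ ≠ xᵢ₊₁`
for `i < l`, together with bits `sᵢ` and words `vᵢ` such that `B sᵢ xᵢ xᵢ₊₁ vᵢ`, where the number of
`i ≤ l` with `sᵢ = 1` has the same parity as `l + p`. -/
inductive Certifies (B : Bool → Word → Word → Word → Prop) (y : Word) :
    ℕ → Bool → Word → Word → Prop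
  | last {k : ℕ} {s : Bool} {v : Word} : B s y y v →
      Certifies B y k s y (s :: (blockCode y ++ blockCode v))
  | step {k : ℕ} {p s : Bool} {x z v r : Word} : z.length = x.length → z ≠ x → B s x z v →
      Certifies B y k (p ^^ s ^^ true) z r →
      Certifies B y (k + 1) p x (s :: (blockCode z ++ (blockCode v ++ r)))

namespace Certifies

variable {B : Bool → Word → Word → Word → Prop} {y : Word} {k : ℕ} {p : Bool} {x u : Word}

theorem exists_eq (h : Certifies B y k p x u) : ∃ s z v r,
    u = s :: (blockCode z ++ (blockCode v ++ r)) ∧ z.length = x.length := by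
  cases h with
  | last h => exact ⟨_, _, _, [], by rw [List.append_nil], rfl⟩
  | step h₁ h₂ h₃ h₄ => exact ⟨_, _, _, _, rfl, h₁⟩

theorem cons_iff {s : Bool} {z v r : Word} :
    Certifies B y k p x (s :: (blockCode z ++ (blockCode v ++ r))) ↔
      B s x z v ∧ (z = x ∧ z = y ∧ p = s ∧ r = [] ∨ z.length = x.length ∧ z ≠ x ∧
        ∃ k', k = k' + 1 ∧ Certifies B y k' (p ^^ s ^^ true) z r) := by
  constructor
  · generalize hu : s :: (blockCode z ++ (blockCode v ++ r)) = u
    intro h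
    cases h with
    | @last _ _ v' h =>
      obtain ⟨rfl, h₁⟩ := List.cons.inj hu
      rw [← List.append_nil (blockCode v')] at h₁
      obtain ⟨rfl, h₂⟩ := blockCode_append_inj h₁
      obtain ⟨rfl, rfl⟩ := blockCode_append_inj h₂
      exact ⟨h, .inl ⟨rfl, rfl, rfl, rfl⟩⟩
    | step h₁ h₂ h₃ h₄ =>
      obtain ⟨rfl, h₅⟩ := List.cons.inj hu
      obtain ⟨rfl, h₆⟩ := blockCode_append_inj h₅
      obtain ⟨rfl, rfl⟩ := blockCode_append_inj h₆
      exact ⟨h₃, .inr ⟨h₁, h₂, _, rfl, h₄⟩⟩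
  · rintro ⟨h, ⟨rfl, rfl, rfl, rfl⟩ | ⟨h₁, h₂, k', rfl, h₄⟩⟩
    · rw [List.append_nil]
      exact .last h
    · exact .step h₁ h₂ h h₄

end Certifies

namespace ChainMachine

open Turing

/-- The machine `A` decides the relation `B`, in time `P` of the length of the code. -/
def DecidesIn (A : TM2ComputableAux (Option Bool) Bool) (P : ℕ → ℕ)
    (B : Word → Word → Word → Prop) : Prop :=
  ∀ x z v, ∃ b : Bool, (b = true ↔ B x z v) ∧
    Nonempty (TM2OutputsInTime A.tm ((encodeWords [x, z, v]).map A.inputAlphabet.symm)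
      (some [A.outputAlphabet.symm b]) (P (encodeWords [x, z, v]).length))

theorem encodeWords_three (x z v : Word) : encodeWords [x, z, v] =
    x.map some ++ none :: (z.map some ++ none :: (v.map some ++ [none])) := by
  simp [encodeWords]

/-- A bound for the time spent on one record of a certificate, if the words involved have length at
most `N`. -/
def recordTime (c : ℕ) (P : ℕ → ℕ) (N : ℕ) : ℕ :=
  (c + 9) * (N + 2) + P (3 * N + 3)

variable {M : Bool → TM2ComputableAux (Option Bool) Bool} {c : ℕ} {p₀ : Bool} {P : ℕ → ℕ}
  {B : Bool → Word → Word → Word → Prop}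

open Classical in
/-- The part of a computation that starts with reading a record of the certificate. -/
theorem record_run (hM : ∀ s, DecidesIn (M s) P (B s)) (hP : Monotone P) (y : Word) {n N : ℕ}
    (hnN : n ≤ N) (L : ℕ) (hL : L ≤ N) (u x : Word) (p : Bool) (lo hi : Fin c → List (Option Bool))
    (hu : u.length ≤ L) (hx : x.length = n) (hn : ∀ d, (lo d).length + (hi d).length = n) :
    Answers M p₀ ((L + 1) * recordTime c P N) (.record p)
      ⟨u.map some ++ [none], x.map some, x.map some, [], (y.map some).reverse, [], lo, hi⟩
      (decide (Certifies B y (odometer n lo) p x u)) := by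
  induction L generalizing u x p lo hi with
  | zero =>
    obtain rfl : u = [] := List.length_eq_zero_iff.1 (Nat.le_zero.1 hu)
    have : ¬ Certifies B y (odometer n lo) p x [] := fun h => by
      obtain ⟨s, z, v, r, h, -⟩ := h.exists_eq
      cases h
    refine ⟨⟨[], x.map some, x.map some, [], (y.map some).reverse, [], lo, hi⟩,
      .mono (.of_step fun w => ?_) (m := 1) ?_⟩
    · simp [code, conf, Tapes.get, Tapes.set, this]
    · simp only [recordTime]; nlinarith
  | succ L ih =>
    obtain _ | ⟨s, u⟩ := u
    · exact (ih (by omega) [] x p lo hi (by simp) hx hn).mono (by gcongr; omega)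
    have hN : ∀ m, m ≤ recordTime c P N →
        m ≤ (L + 1 + 1) * recordTime c P N := fun m hm => by nlinarith
    -- Read the bit `s` and copy `x` to the query.
    have hcop : GoesTo M p₀ (1 + (n + 1)) (.record p)
        ⟨(s :: u).map some ++ [none], x.map some, x.map some, [], (y.map some).reverse, [], lo, hi⟩
        (.readZ s p false)
        ⟨u.map some ++ [none], [], x.map some, [], (y.map some).reverse,
          none :: ((x.map some).reverse ++ []), lo, hi⟩ := by
      have h := copy_run (M := M) (p₀ := p₀) (i := u.map some ++ [none]) (x₂ := x.map some)
        (t := []) (y := (y.map some).reverse) (q := []) (lo := lo) (hi := hi) s p (x.map some)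
      rw [List.length_map, hx] at h
      exact .trans (.of_step fun w => by simp [code, conf, Tapes.get, Tapes.set]) h
    simp only [List.length_cons] at hu
    -- If the two blocks cannot be read, then no certificate starts like this.
    by_cases hz : ∀ z r, u = blockCode z ++ r → z.length ≠ x.length
    · have : ¬ Certifies B y (odometer n lo) p x (s :: u) := fun h => by
        obtain ⟨s', z, v, r, h, h'⟩ := h.exists_eq
        exact hz z _ (List.cons.inj h).2 h'
      rw [decide_eq_false this]
      refine (Answers.of_goesTo hcop (readZ_reject u x hz)).mono (hN _ ?_)
      simp only [recordTime]; nlinarith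
    push Not at hz
    obtain ⟨z, r, rfl, hzx⟩ := hz
    have hred := hcop.trans (readZ_run z x r hzx)
    by_cases hv : ∀ v r', r ≠ blockCode v ++ r'
    · have : ¬ Certifies B y (odometer n lo) p x (s :: (blockCode z ++ r)) := fun h => by
        obtain ⟨s', z', v, r', h, h'⟩ := h.exists_eq
        exact hv v r' (blockCode_append_inj (List.cons.inj h).2).2
      rw [decide_eq_false this]
      refine (Answers.of_goesTo hred (readV_reject r hv)).mono (hN _ ?_)
      simp only [List.length_append] at hu
      simp only [recordTime]; nlinarith
    push Not at hv
    obtain ⟨v, r, rfl⟩ := hv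
    obtain ⟨b, hb, ⟨hcall⟩⟩ := hM s x z v
    have hq : none :: ((v.map some).reverse ++ none :: ((z.map some).reverse ++
        none :: ((x.map some).reverse ++ []))) = (encodeWords [x, z, v]).reverse := by
      simp [encodeWords_three]
    have hred₂ := hred.trans (readV_run v r)
    rw [hq] at hred₂
    have hred₃ := hred₂.trans (call_run hcall)
    simp only [List.length_append, length_blockCode] at hu
    -- The three words of the query have length at most `N`.
    have hlen : (encodeWords [x, z, v]).length ≤ 3 * N + 3 := by
      simp only [encodeWords_three, List.length_append, List.length_cons, List.length_map,
        List.length_nil]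
      omega
    have hPle := hP hlen
    rw [Certifies.cons_iff, ← hb]
    obtain _ | _ := b
    · simp only [Bool.false_eq_true, false_and, decide_false]
      refine ⟨_, hred₃.mono (hN _ ?_)⟩
      simp only [recordTime]; nlinarith
    simp only [true_and]
    -- A record with `z = x` has to be the last one.
    by_cases hzx' : z = x
    · subst hzx'
      simp only [ne_eq, not_true_eq_false, false_and, and_false, or_false, true_and, decide_false,
        Bool.or_false] at hred₃ ⊢
      by_cases hps : p = s
      · subst hps
        simp only [afterCall, if_true, Bool.false_eq_true, if_false] at hred₃
        simp only [true_and]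
        by_cases hzy : z = y
        · subst hzy
          simp only [true_and]
          rw [List.append_nil] at hred₃
          have h := Answers.of_goesTo (hred₃.trans (compare_run _)) (final_run (i := []) r)
          simp only [List.length_reverse, List.length_map] at h
          refine h.mono (hN _ ?_)
          simp only [recordTime]; nlinarith
        · simp only [hzy, false_and, decide_false]
          rw [List.append_nil] at hred₃
          have h := Answers.of_goesTo hred₃ (compare_reject (z.map some).reverse
            (y.map some).reverse (by
              rw [ne_eq, List.reverse_inj, List.map_inj_right (fun _ _ => Option.some.inj)]
              exact hzy))
          simp only [List.length_reverse, List.length_map] at h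
          refine h.mono (hN _ ?_)
          simp only [recordTime]; nlinarith
      · simp only [hps, false_and, and_false, decide_false]
        simp only [afterCall, if_true, Bool.false_eq_true, if_false, hps] at hred₃
        refine ⟨_, hred₃.mono (hN _ ?_)⟩
        simp only [recordTime]; nlinarith
    · simp only [hzx', false_and, false_or, hzx, ne_eq, not_false_eq_true, true_and, decide_true,
        Bool.or_true] at hred₃ ⊢
      simp only [afterCall, if_true] at hred₃
      rcases tick_run (M := M) (p₀ := p₀) (p := p ^^ s ^^ true) (n := n) (v := odometer n lo) 0 hn
        (by simp) (by simp) with ⟨h0, h⟩ | ⟨lo', hi', hn', hodo, h⟩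
      · have : ¬ ∃ k', odometer n lo = k' + 1 ∧ Certifies B y k' (p ^^ s ^^ true) z r := by
          rintro ⟨k', hk', -⟩
          omega
        rw [decide_eq_false this]
        refine (Answers.of_goesTo hred₃ h).mono (hN _ ?_)
        simp only [recordTime, Fin.val_zero, Nat.sub_zero]; nlinarith
      · have hiff : (∃ k', odometer n lo = k' + 1 ∧ Certifies B y k' (p ^^ s ^^ true) z r) ↔
            Certifies B y (odometer n lo') (p ^^ s ^^ true) z r := by
          rw [← hodo]
          constructor
          · rintro ⟨k', hk', h⟩
            rwa [Nat.succ.inj hk']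
          · exact fun h => ⟨_, rfl, h⟩
        have hspr := (hred₃.trans h).trans (spread_some_run _ _)
        simp only [List.append_nil, List.reverse_reverse, List.length_reverse,
          List.length_map] at hspr
        have hih := ih (by omega) r z (p ^^ s ^^ true) lo' hi' (by omega) (hzx.trans hx) hn'
        simp only [hiff]
        refine (Answers.of_goesTo hspr hih).mono ?_
        rw [add_mul (L + 1), one_mul, add_comm]
        gcongr
        simp only [recordTime, Fin.val_zero, Nat.sub_zero]; nlinarith

end ChainMachine

/-! ### Certificates are checked in polynomial time -/

theorem Polynomial.monotone_eval_nat (q : Polynomial ℕ) : Monotone fun n => q.eval n := by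
  intro a b hab
  simp only [Polynomial.eval_eq_sum, Polynomial.sum]
  gcongr

theorem encodeTuple_three (v : Fin 3 → Word) : encodeTuple v = encodeWords [v 0, v 1, v 2] := by
  simp [encodeTuple, List.ofFn_succ]

namespace ChainMachine

open Turing

variable {M : Bool → TM2ComputableAux (Option Bool) Bool} {c : ℕ} {p₀ : Bool} {P : ℕ → ℕ}
  {B : Bool → Word → Word → Word → Prop}

open Classical in
/-- A computation up to the point where the answer is known. -/
theorem start_run (hM : ∀ s, DecidesIn (M s) P (B s)) (hP : Monotone P) (x y u : Word) {N : ℕ}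
    (hN : (encodeWords [x, y, u]).length = N) :
    Answers M p₀ ((2 * N + 3) * (recordTime c P N + 1)) (.initX : Label c)
      ⟨encodeWords [x, y, u], [], [], [], [], [], fun _ => [], fun _ => []⟩
      (decide (Certifies B y ((x.length + 1) ^ c - 1) p₀ x u)) := by
  rw [encodeWords_three] at hN ⊢
  simp only [List.length_append, List.length_cons, List.length_map, List.length_nil] at hN
  have h₁ := ((initX_run (M := M) (p₀ := p₀) (c := c) (x := []) (x₂ := []) (t := []) (y := [])
    (q := []) (lo := fun _ => []) (hi := fun _ => []) x
    (y.map some ++ none :: (u.map some ++ [none]))).trans (spread_none_run _)).trans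
    (initY_run y (u.map some ++ [none]))
  simp only [List.append_nil, List.reverse_reverse, List.length_reverse, List.length_map] at h₁
  have h₂ := record_run (p₀ := p₀) hM hP y (n := x.length) (N := N) (by omega) u.length (by omega)
    u x p₀ (fun _ : Fin c => x.map some) (fun _ => []) le_rfl rfl (by simp)
  have hodo := odometer_full (lo := fun _ : Fin c => x.map some) (n := x.length) (by simp)
  rw [Nat.eq_sub_of_add_eq hodo] at h₂
  refine (Answers.of_goesTo h₁ h₂).mono ?_
  have : (u.length + 1) * recordTime c P N ≤ N * recordTime c P N := by gcongr; omega
  nlinarith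

/-- The answer is written to the output stack, and the internal state is reset. -/
theorem finish_run (r : Bool) (w : Scratch) : ReachIn (machine M c p₀).step 1
    (conf M (.finish r) w .empty (noSub M)) (haltList (machine M c p₀) [r]) := by
  refine ⟨_, rfl, ?_⟩
  have hstk := stk_haltList (machine M c p₀) [r]
  have h : TM2.stepAux (code M c p₀ (.finish r)) (w, fun s => (M s).tm.initialState)
      (contents .empty (noSub M)) = haltList (machine M c p₀) [r] := by
    refine (TM2.Cfg.mk.injEq ..).mpr ⟨rfl, rfl, ?_⟩
    refine Eq.trans ?_ hstk.symm
    funext k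
    rcases k with _ | t | k
    · simp only [Function.update_self]
      rfl
    · rw [Function.update_of_ne (by simp)]
      cases t <;> rfl
    · rfl
  exact h

open Classical in
/-- The cleaning phase depends on the contents of the tapes, which the growth rate `W` of the machine
bounds. -/
theorem exists_outputsInTime (hM : ∀ s, DecidesIn (M s) P (B s)) (hP : Monotone P) :
    ∃ W : ℕ, ∀ (x y u : Word) (N : ℕ), (encodeWords [x, y, u]).length = N →
      Nonempty (TM2OutputsInTime (machine M c p₀) (encodeWords [x, y, u])
        (some [decide (Certifies B y ((x.length + 1) ^ c - 1) p₀ x u)])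
        ((2 * N + 3) * (recordTime c P N + 1) * (W + 1) + N + 2)) := by
  obtain ⟨W, hW⟩ := (machine M c p₀).exists_length_le
  refine ⟨W, fun x y u N hN => ?_⟩
  set r := decide (Certifies B y ((x.length + 1) ^ c - 1) p₀ x u) with hr
  obtain ⟨S, hS⟩ := start_run (p₀ := p₀) (c := c) hM hP x y u hN
  obtain ⟨w₁, m, hm, h₁⟩ := hS (none, none)
  obtain ⟨w₂, m', hm', h₂⟩ := clean_run (M := M) (p₀ := p₀) (N + m * W) r S
    (fun t => by
      refine (hW _ _ _ h₁ (some (.inl t))).trans (Nat.add_le_add_right ?_ _)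
      cases t
      case inp => exact hN.le
      all_goals exact Nat.zero_le _) w₁
  have hinit : initList (machine M c p₀) (encodeWords [x, y, u]) = conf M .initX (none, none)
      ⟨encodeWords [x, y, u], [], [], [], [], [], fun _ => [], fun _ => []⟩ (noSub M) := by
    refine (TM2.Cfg.mk.injEq ..).mpr ⟨rfl, rfl, ?_⟩
    refine (stk_initList (machine M c p₀) _).trans ?_
    funext k
    rcases k with _ | t | k
    · rfl
    · by_cases ht : t = .inp
      · subst ht
        exact Function.update_self ..
      · refine (Function.update_of_ne ?_ _ _).trans ?_
        · intro h
          exact ht (Sum.inl.inj (Option.some.inj h))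
        · cases t <;> first | rfl | exact absurd rfl ht
    · rfl
  have h := (h₁.trans h₂).trans (finish_run r w₂)
  rw [← hinit] at h
  refine ⟨⟨⟨_, ReachIn.iff_iterate.1 h⟩, ?_⟩⟩
  have : m * W ≤ (2 * N + 3) * (recordTime c P N + 1) * W := Nat.mul_le_mul_right _ hm
  rw [mul_add, mul_one]
  change m + m' + 1 ≤ _
  omega

end ChainMachine

open ChainMachine in
/-- Certificates of chains can be checked in polynomial time. -/
theorem polyTimeDecidable_certifies {B : Bool → Word → Word → Word → Prop}
    (hB : ∀ s, PolyTimeDecidable encodeTuple fun v : Fin 3 → Word => B s (v 0) (v 1) (v 2))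
    (c : ℕ) (p : Bool) :
    PolyTimeDecidable encodeTuple fun v : Fin 3 → Word =>
      Certifies B (v 1) (((v 0).length + 1) ^ c - 1) p (v 0) (v 2) := by
  classical
  let D := fun s => (hB s).some
  let P : Polynomial ℕ := (D false).time + (D true).time
  have hP : Monotone fun n => P.eval n := P.monotone_eval_nat
  have hM : ∀ s, DecidesIn (D s).toTM2ComputableAux (fun n => P.eval n) (B s) := by
    intro s x z v
    refine ⟨decide (B s x z v), decide_eq_true_iff, ⟨?_⟩⟩
    have h := (D s).outputsFun ![x, z, v]
    rw [encodeTuple_three] at h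
    refine ⟨⟨_, ?_⟩, h.steps_le_m.trans ?_⟩
    · convert! h.evals_in_steps
    · simp only [P, Polynomial.eval_add]
      cases s
      · exact Nat.le_add_right _ _
      · exact Nat.le_add_left _ _
  obtain ⟨W, hW⟩ := exists_outputsInTime (c := c) (p₀ := p) hM hP
  refine ⟨{ tm := machine (fun s => (D s).toTM2ComputableAux) c p
            inputAlphabet := Equiv.refl (Option Bool)
            outputAlphabet := Equiv.refl Bool
            time := (2 * .X + 3) * (((c : Polynomial ℕ) + 9) * (.X + 2) + P.comp (3 * .X + 3) + 1) *
              ((W : Polynomial ℕ) + 1) + .X + 2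
            outputsFun := fun v => ?_ }⟩
  have h := (hW (v 0) (v 1) (v 2) _ rfl).some
  rw [← encodeTuple_three] at h
  refine ⟨⟨h.steps, ?_⟩, h.steps_le_m.trans (le_of_eq ?_)⟩
  · convert! h.evals_in_steps
    exact congrArg _ (List.map_id _)
  · simp [recordTime]

/-! ### Counting certificates -/

/-- The set of words of length `n`. -/
noncomputable def wordsOfLength (n : ℕ) : Finset Word := (List.finite_length_eq Bool n).toFinset

theorem mem_wordsOfLength {n : ℕ} {w : Word} : w ∈ wordsOfLength n ↔ w.length = n := by
  simp [wordsOfLength]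

open Classical in
/-- The `(x, y)` entry of `∑ (-N)ˡ E`, where `l < k`, and `E` and `N` are the diagonal and the
off-diagonal part of the matrix `a`, restricted to words of the length of `x`. -/
noncomputable def chainSum (a : Word → Word → ℤ) (y : Word) : ℕ → Word → ℤ
  | 0, _ => 0
  | k + 1, x => ∑ z ∈ wordsOfLength x.length,
      a x z * if z = x then if x = y then 1 else 0 else -chainSum a y k z

namespace Certifies

variable {B : Bool → Word → Word → Word → Prop} {y : Word} {k : ℕ} {p : Bool} {x : Word}

theorem length_le {Q : ℕ → ℕ}
    (hQ : ∀ s x z v, B s x z v → z.length = x.length → v.length ≤ Q x.length) {u : Word}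
    (h : Certifies B y k p x u) :
    u.length ≤ (k + 1) * (2 * x.length + 2 * Q x.length + 3) := by
  induction h with
  | @last k s v hB =>
    have := hQ _ _ _ _ hB rfl
    simp only [List.length_cons, List.length_append, length_blockCode]
    nlinarith [Nat.zero_le (k * (2 * y.length + 2 * Q y.length + 3))]
  | @step k p s x z v r h₁ h₂ hB h₄ ih =>
    have := hQ _ _ _ _ hB h₁
    rw [h₁] at ih
    simp only [List.length_cons, List.length_append, length_blockCode, h₁]
    rw [add_mul (k + 1), one_mul]
    omega

/-- What may follow the first triple of a certificate. -/
def tails (B : Bool → Word → Word → Word → Prop) (y : Word) (k : ℕ) (p s : Bool) (x z : Word) :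
    Set Word :=
  {r | z = x ∧ z = y ∧ p = s ∧ r = [] ∨ z.length = x.length ∧ z ≠ x ∧
    ∃ k', k = k' + 1 ∧ Certifies B y k' (p ^^ s ^^ true) z r}

/-- A certificate amounts to its first triple and the rest. -/
theorem bijective_cons : Function.Bijective
    (fun t : (sz : Bool × {z // z ∈ wordsOfLength x.length}) ×
        {v // B sz.1 x sz.2 v} × tails B y k p sz.1 x sz.2 =>
      (⟨t.1.1 :: (blockCode t.1.2 ++ (blockCode t.2.1 ++ t.2.2)),
        cons_iff.2 ⟨t.2.1.2, t.2.2.2⟩⟩ : {u // Certifies B y k p x u})) := by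
  constructor
  · rintro ⟨⟨s, z, hz⟩, ⟨v, hv⟩, ⟨r, hr⟩⟩ ⟨⟨s', z', hz'⟩, ⟨v', hv'⟩, ⟨r', hr'⟩⟩ h
    obtain ⟨h₁, h₂⟩ := List.cons.inj (Subtype.ext_iff.1 h)
    obtain ⟨h₃, h₄⟩ := blockCode_append_inj h₂
    obtain ⟨h₅, h₆⟩ := blockCode_append_inj h₄
    dsimp only at h₁ h₃ h₅ h₆
    subst h₁ h₃ h₅ h₆
    rfl
  · rintro ⟨u, hu⟩
    obtain ⟨s, z, v, r, rfl, hz⟩ := hu.exists_eq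
    obtain ⟨hv, hr⟩ := cons_iff.1 hu
    exact ⟨⟨⟨s, z, mem_wordsOfLength.2 hz⟩, ⟨v, hv⟩, ⟨r, hr⟩⟩, rfl⟩

variable {Q : ℕ → ℕ}

theorem finite (hQ : ∀ s x z v, B s x z v → z.length = x.length → v.length ≤ Q x.length) :
    {u | Certifies B y k p x u}.Finite :=
  (List.finite_length_le Bool _).subset fun _ h => length_le hQ h

theorem finite_tails (hQ : ∀ s x z v, B s x z v → z.length = x.length → v.length ≤ Q x.length)
    (s : Bool) (z : Word) : (tails B y k p s x z).Finite := by
  refine ((Set.finite_singleton []).union (finite (y := y) (k := k - 1) (p := p ^^ s ^^ true)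
    (x := z) hQ)).subset ?_
  rintro r (⟨-, -, -, rfl⟩ | ⟨-, -, k', rfl, h⟩)
  · exact .inl rfl
  · exact .inr h

theorem ncard_eq_sum (hQ : ∀ s x z v, B s x z v → z.length = x.length → v.length ≤ Q x.length) :
    {u | Certifies B y k p x u}.ncard = ∑ z ∈ wordsOfLength x.length,
      ∑ s, {v | B s x z v}.ncard * (tails B y k p s x z).ncard := by
  have h₁ : ∀ sz : Bool × {z // z ∈ wordsOfLength x.length},
      Finite {v // B sz.1 x sz.2 v} := fun sz =>
    ((List.finite_length_le Bool _).subset fun _ h =>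
      hQ _ _ _ _ h (mem_wordsOfLength.1 sz.2.2) : {v | B sz.1 x sz.2 v}.Finite).to_subtype
  have h₂ : ∀ sz : Bool × {z // z ∈ wordsOfLength x.length},
      Finite (tails B y k p sz.1 x sz.2) := fun sz => (finite_tails hQ _ _).to_subtype
  rw [← Nat.card_coe_set_eq]
  refine (Nat.card_congr (Equiv.ofBijective _ bijective_cons)).symm.trans ?_
  rw [Nat.card_sigma, Fintype.sum_prod_type_right, ← Finset.sum_coe_sort (wordsOfLength x.length)]
  refine Finset.sum_congr rfl fun z _ => Finset.sum_congr rfl fun s _ => ?_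
  rw [Nat.card_prod, ← Nat.card_coe_set_eq, ← Nat.card_coe_set_eq]
  rfl

theorem tails_self (s : Bool) :
    tails B y k p s x x = if x = y ∧ p = s then {[]} else ∅ := by
  split_ifs with h
  · ext r; simp [tails, h.1, h.2]
  · ext r
    simp only [tails, ne_eq, not_true_eq_false, false_and, and_false, or_false, true_and,
      Set.mem_ofPred_eq, Set.mem_empty_iff_false, iff_false]
    exact fun h' => h ⟨h'.1, h'.2.1⟩

theorem tails_zero {z : Word} (hz : z ≠ x) (s : Bool) : tails B y 0 p s x z = ∅ := by
  ext r; simp [tails, hz]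

theorem tails_succ {z : Word} (hz : z ≠ x) (hzx : z.length = x.length) (s : Bool) :
    tails B y (k + 1) p s x z = {r | Certifies B y k (p ^^ s ^^ true) z r} := by
  ext r; simp [tails, hz, hzx]

/-- The certificates, counted with signs, add up to the alternating sum over chains. -/
theorem ncard_sub_ncard {a : Word → Word → ℤ}
    (hQ : ∀ s x z v, B s x z v → z.length = x.length → v.length ≤ Q x.length)
    (ha : ∀ x z, a x z = {v | B false x z v}.ncard - {v | B true x z v}.ncard) :
    ({u | Certifies B y k false x u}.ncard : ℤ) - {u | Certifies B y k true x u}.ncard =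
      chainSum a y (k + 1) x := by
  induction k generalizing x with
  | zero =>
    rw [ncard_eq_sum hQ, ncard_eq_sum hQ, chainSum]
    push_cast
    rw [← Finset.sum_sub_distrib]
    refine Finset.sum_congr rfl fun z hz => ?_
    rw [Fintype.sum_bool, Fintype.sum_bool, ha]
    by_cases hzx : z = x
    · subst hzx
      by_cases hzy : z = y <;> simp [tails_self, hzy]
    · simp [tails_zero hzx, hzx, chainSum]
  | succ k ih =>
    rw [ncard_eq_sum hQ, ncard_eq_sum hQ, chainSum]
    push_cast
    rw [← Finset.sum_sub_distrib]
    refine Finset.sum_congr rfl fun z hz => ?_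
    rw [Fintype.sum_bool, Fintype.sum_bool, ha]
    by_cases hzx : z = x
    · subst hzx
      by_cases hzy : z = y <;> simp [tails_self, hzy]
    · simp only [tails_succ hzx (mem_wordsOfLength.1 hz), hzx, if_false, ← ih]
      simp only [Bool.false_bne, Bool.true_bne, Bool.not_true, Bool.not_false]
      ring

end Certifies

theorem encodeTuple_two (w : Fin 2 → Word) : (encodeTuple w).length =
    (w 0).length + (w 1).length + 2 := by
  simp [encodeTuple, encodeWords, List.ofFn_succ]
  ring

open Certifies in
/-- `GapP` is closed under alternating sums over chains of polynomial length. -/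
theorem isGapP_chainSum {f : (Fin 2 → Word) → ℤ} (hf : IsGapP f) (c : ℕ) :
    IsGapP fun w : Fin 2 → Word =>
      chainSum (fun x z => f ![x, z]) (w 1) (((w 0).length + 1) ^ c - 1 + 1) (w 0) := by
  obtain ⟨g, h, ⟨B₀, q₀, hB₀, hg⟩, ⟨B₁, q₁, hB₁, hh⟩, hf⟩ := hf
  let B : Bool → Word → Word → Word → Prop := fun s x z v =>
    (Fin.snoc ![x, z] v : Fin 3 → Word) ∈ cond s B₁ B₀
  let q : Polynomial ℕ := (q₀ + q₁).comp (2 * .X + 2)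
  have hsnoc : ∀ v : Fin 3 → Word, (Fin.snoc ![v 0, v 1] (v 2) : Fin 3 → Word) = v := by
    intro v
    funext i
    fin_cases i <;> rfl
  have hsnoc' : ∀ (w : Fin 2 → Word) (u : Word),
      (Fin.snoc w u : Fin 3 → Word) 0 = w 0 ∧ (Fin.snoc w u : Fin 3 → Word) 1 = w 1 ∧
        (Fin.snoc w u : Fin 3 → Word) 2 = u := fun w u => ⟨rfl, rfl, rfl⟩
  have hQ : ∀ s x z v, B s x z v → z.length = x.length → v.length ≤ q.eval x.length := by
    intro s x z v hv hz
    have hlen : (encodeTuple ![x, z]).length = 2 * x.length + 2 := by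
      rw [encodeTuple_two]
      simp [hz]
      ring
    simp only [q, Polynomial.eval_comp, Polynomial.eval_add, Polynomial.eval_mul,
      Polynomial.eval_X, Polynomial.eval_ofNat, ← hlen]
    cases s
    · exact ((hg ![x, z]).1 v hv).trans (Nat.le_add_right _ _)
    · exact ((hh ![x, z]).1 v hv).trans (Nat.le_add_left _ _)
  have hdec : ∀ s, PolyTimeDecidable encodeTuple fun v : Fin 3 → Word => B s (v 0) (v 1) (v 2) := by
    intro s
    simp only [B, hsnoc]
    cases s
    · exact hB₀
    · exact hB₁
  have hsharp : ∀ p, IsSharpP fun w : Fin 2 → Word =>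
      {u | Certifies B (w 1) (((w 0).length + 1) ^ c - 1) p (w 0) u}.ncard := by
    intro p
    refine ⟨{v | Certifies B (v 1) (((v 0).length + 1) ^ c - 1) p (v 0) (v 2)},
      ((.X + 1) ^ c + 1) * (2 * .X + 2 * q + 3), polyTimeDecidable_certifies hdec c p, fun w => ?_⟩
    simp only [Set.mem_ofPred_eq, hsnoc']
    refine ⟨fun u hu => (length_le (Q := fun n => q.eval n) hQ hu).trans ?_, trivial⟩
    have hle : (w 0).length ≤ (encodeTuple w).length := by rw [encodeTuple_two]; omega
    have hqle := q.monotone_eval_nat hle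
    simp only [Polynomial.eval_mul, Polynomial.eval_add, Polynomial.eval_pow, Polynomial.eval_X,
      Polynomial.eval_one, Polynomial.eval_ofNat] at hqle ⊢
    gcongr
    exact (Nat.sub_le _ _).trans (by gcongr)
  refine ⟨_, _, hsharp false, hsharp true, fun w => (ncard_sub_ncard (Q := fun n => q.eval n) hQ fun x z => ?_).symm⟩
  rw [hf, (hg _).2, (hh _).2]
  rfl

/-! ### The inverse in the incidence algebra -/

namespace WordPoset

variable (P : WordPoset) (η : P.carrier → P.carrier → ℤ)

theorem mem_level {n : ℕ} {x : P.carrier} : x ∈ P.level n ↔ x.1.length = n := by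
  simp [level]

/-- Every chain that lies above `x` has at most `k` elements. -/
def ChainsBounded (k : ℕ) (x : P.carrier) : Prop :=
  ∀ t : Finset P.carrier, (∀ z ∈ t, P.le x z) → IsChain P.le (t : Set P.carrier) → t.card ≤ k

variable {P η}

theorem ChainsBounded.of_lt {k : ℕ} {x z : P.carrier} (h : P.ChainsBounded (k + 1) x)
    (hxz : P.le x z) (hne : z ≠ x) : P.ChainsBounded k z := by
  classical
  intro t ht hc
  have hx : x ∉ t := fun hx => hne (P.le_antisymm _ _ (ht x hx) hxz)
  have hle : ∀ w ∈ t, P.le x w := fun w hw => P.le_trans _ _ _ hxz (ht w hw)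
  have := h (insert x t)
    (Finset.forall_mem_insert _ _ _ |>.2 ⟨P.le_refl x, hle⟩)
    (by
      rw [Finset.coe_insert]
      exact hc.insert fun w hw _ => .inl (hle w hw))
  rw [Finset.card_insert_of_notMem hx] at this
  omega

theorem ChainsBounded.pos {k : ℕ} {x : P.carrier} (h : P.ChainsBounded k x) : 0 < k := by
  have := h {x} (by simpa using P.le_refl x) (by simp)
  rwa [Finset.card_singleton] at this

theorem chainsBounded_card (x : P.carrier) :
    P.ChainsBounded (P.level x.1.length).card x := fun _ ht _ =>
  Finset.card_le_card fun z hz => (P.mem_level).2 (P.length_eq _ _ (ht z hz)).symm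

theorem chainsBounded_of_chainHeight_le {k : ℕ} {x : P.carrier}
    (h : Set.chainHeight (P.level x.1.length : Set P.carrier) P.le ≤ (k : ℕ∞)) :
    P.ChainsBounded k x := by
  intro t ht hc
  have := (Set.encard_le_chainHeight_of_isChain _ _ (fun z hz =>
    Finset.mem_coe.2 ((P.mem_level).2 (P.length_eq _ _ (ht z hz)).symm)) hc).trans h
  rw [Set.encard_coe_eq_coe_finsetCard] at this
  exact_mod_cast this

variable (P η) in
/-- The function on pairs of words that extends `η` by zero. -/
noncomputable abbrev ext₂ (x z : Word) : ℤ := P.extend η ![x, z]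

theorem ext₂_coe (x z : P.carrier) : P.ext₂ η x z = η x z := by
  simp [ext₂, extend]

theorem ext₂_of_notMem {x z : Word} (h : ¬ (x ∈ P.carrier ∧ z ∈ P.carrier)) :
    P.ext₂ η x z = 0 := by
  simp only [ext₂, extend]
  exact dif_neg h

theorem sum_ext₂ (x : P.carrier) (f : Word → ℤ) :
    ∑ z ∈ wordsOfLength x.1.length, P.ext₂ η x z * f z =
      ∑ z ∈ P.level x.1.length, η x z * f z := by
  classical
  rw [← Finset.sum_subset (s₁ := (P.level x.1.length).map ⟨Subtype.val, Subtype.val_injective⟩)]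
  · rw [Finset.sum_map]
    simp [ext₂_coe]
  · intro z hz
    obtain ⟨z, hz', rfl⟩ := Finset.mem_map.1 hz
    exact mem_wordsOfLength.2 (P.mem_level.1 hz')
  · intro z hz hz'
    rw [ext₂_of_notMem, zero_mul]
    exact fun h => hz' (Finset.mem_map.2
      ⟨⟨z, h.2⟩, P.mem_level.2 (mem_wordsOfLength.1 hz), rfl⟩)

open Classical in
theorem chainSum_succ (k : ℕ) (x : P.carrier) (y : Word) :
    chainSum (P.ext₂ η) y (k + 1) x = ∑ z ∈ P.level x.1.length,
      η x z * if z = x then if x.1 = y then 1 else 0 else -chainSum (P.ext₂ η) y k z := by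
  rw [chainSum, sum_ext₂]
  simp only [Subtype.coe_inj]

theorem chainSum_of_notMem {k : ℕ} {x y : Word} (h : ¬ (x ∈ P.carrier ∧ y ∈ P.carrier)) :
    chainSum (P.ext₂ η) y k x = 0 := by
  induction k generalizing x with
  | zero => rfl
  | succ k ih =>
    rw [chainSum]
    refine Finset.sum_eq_zero fun z _ => ?_
    by_cases hx : x ∈ P.carrier ∧ z ∈ P.carrier
    · have hy : y ∉ P.carrier := fun hy => h ⟨hx.1, hy⟩
      rw [ih fun h => hy h.2, if_neg fun hxy : x = y => hy (hxy ▸ hx.1)]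
      simp
    · rw [ext₂_of_notMem hx, zero_mul]

theorem le_of_chainSum_ne_zero (hη : P.InIncidenceAlgebra η) {k : ℕ} {x y : P.carrier}
    (h : chainSum (P.ext₂ η) y k x ≠ 0) : P.le x y := by
  induction k generalizing x with
  | zero => exact absurd rfl h
  | succ k ih =>
    rw [chainSum_succ] at h
    obtain ⟨z, -, hz⟩ := Finset.exists_ne_zero_of_sum_ne_zero h
    have hxz := hη _ _ (left_ne_zero_of_mul hz)
    have hz' := right_ne_zero_of_mul hz
    split_ifs at hz' with h₁ h₂
    · rw [Subtype.ext h₂]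
      exact P.le_refl y
    · exact absurd rfl hz'
    · exact P.le_trans _ _ _ hxz (ih (neg_ne_zero.1 hz'))

open Classical in
theorem IsInverse.sum_eq {ρ : P.carrier → P.carrier → ℤ} (h : P.IsInverse η ρ) (x y : P.carrier) :
    ∑ z ∈ P.level x.1.length, η x z * ρ z y = if x = y then 1 else 0 := by
  by_cases hxy : x.1.length = y.1.length
  · exact h.2 _ x (P.mem_level.2 rfl) y (P.mem_level.2 hxy.symm)
  · rw [if_neg fun h => hxy (by rw [h])]
    refine Finset.sum_eq_zero fun z hz => ?_
    by_cases hzy : ρ z y = 0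
    · rw [hzy, mul_zero]
    · exact absurd ((P.mem_level.1 hz).symm.trans (P.length_eq _ _ (h.1 _ _ hzy))) hxy

open Classical in
/-- Split off the diagonal term. -/
theorem Unitriangular.sum_eq (hη : P.Unitriangular η) (x : P.carrier) (f : P.carrier → ℤ) :
    ∑ z ∈ P.level x.1.length, η x z * f z =
      f x + ∑ z ∈ (P.level x.1.length).erase x, η x z * f z := by
  rw [← Finset.add_sum_erase _ _ (P.mem_level.2 rfl), hη.2, one_mul]

open Classical in
theorem Unitriangular.chainSum_succ (hη : P.Unitriangular η) (k : ℕ) (x y : P.carrier) :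
    chainSum (P.ext₂ η) y (k + 1) x = (if x = y then 1 else 0) -
      ∑ z ∈ (P.level x.1.length).erase x, η x z * chainSum (P.ext₂ η) y k z := by
  rw [WordPoset.chainSum_succ, hη.sum_eq, if_pos rfl, sub_eq_add_neg, ← Finset.sum_neg_distrib]
  congr 1
  · simp only [Subtype.coe_inj]
  · refine Finset.sum_congr rfl fun z hz => ?_
    rw [if_neg (Finset.ne_of_mem_erase hz), mul_neg]

/-- An inverse of `η` is the alternating sum over chains. -/
theorem IsInverse.eq_chainSum (hη : P.Unitriangular η) {ρ : P.carrier → P.carrier → ℤ}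
    (h : P.IsInverse η ρ) {k : ℕ} {x : P.carrier} (hx : P.ChainsBounded k x) (y : P.carrier) :
    ρ x y = chainSum (P.ext₂ η) y k x := by
  classical
  induction k generalizing x with
  | zero => exact absurd hx.pos (lt_irrefl 0)
  | succ k ih =>
    rw [hη.chainSum_succ, ← h.sum_eq x y, hη.sum_eq, add_sub_assoc, ← Finset.sum_sub_distrib]
    refine (add_eq_left.2 (Finset.sum_eq_zero fun z hz => ?_)).symm
    by_cases hz0 : η x z = 0
    · simp [hz0]
    · rw [ih (hx.of_lt (hη.1 _ _ hz0) (Finset.ne_of_mem_erase hz)), sub_self]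

/-- The alternating sum over chains becomes stationary once it includes all chains. -/
theorem Unitriangular.chainSum_stable (hη : P.Unitriangular η) {k : ℕ} {x : P.carrier}
    (hx : P.ChainsBounded k x) (y : P.carrier) :
    chainSum (P.ext₂ η) y (k + 1) x = chainSum (P.ext₂ η) y k x := by
  classical
  induction k generalizing x with
  | zero => exact absurd hx.pos (lt_irrefl 0)
  | succ k ih =>
    rw [hη.chainSum_succ (k + 1), hη.chainSum_succ k]
    congr 1
    refine Finset.sum_congr rfl fun z hz => ?_
    by_cases hz0 : η x z = 0
    · simp [hz0]
    · rw [ih (hx.of_lt (hη.1 _ _ hz0) (Finset.ne_of_mem_erase hz))]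

theorem Unitriangular.isInverse_chainSum (hη : P.Unitriangular η) :
    P.IsInverse η fun x y => chainSum (P.ext₂ η) y (P.level x.1.length).card x := by
  classical
  refine ⟨fun x y h => le_of_chainSum_ne_zero hη.1 h, ?_⟩
  rintro n x hx y -
  obtain rfl := P.mem_level.1 hx
  have hsum : ∀ z ∈ (P.level x.1.length).erase x,
      η x z * chainSum (P.ext₂ η) y (P.level z.1.length).card z =
        η x z * chainSum (P.ext₂ η) y (P.level x.1.length).card z := fun z hz => by
    rw [P.mem_level.1 (Finset.mem_of_mem_erase hz)]
  rw [hη.sum_eq, Finset.sum_congr rfl hsum]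
  dsimp only
  rw [← hη.chainSum_stable (chainsBounded_card x), hη.chainSum_succ, sub_add_cancel]

/-- Under polynomial height, a power of `n + 1` bounds the chains in `X_n`, even for `n = 0`. -/
theorem PolynomialHeight.exists_chainsBounded (h : P.PolynomialHeight) :
    ∃ c : ℕ, ∀ x : P.carrier, P.ChainsBounded ((x.1.length + 1) ^ c - 1 + 1) x := by
  obtain ⟨C, c, h⟩ := h
  refine ⟨C + c, fun x => ?_⟩
  rw [Nat.sub_add_cancel (Nat.one_le_pow _ _ (Nat.succ_pos _))]
  rcases Nat.eq_zero_or_pos x.1.length with hn | hn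
  · -- The empty word is the only word of length `0`.
    refine fun t ht hc => (chainsBounded_card x t ht hc).trans ?_
    rw [hn, Nat.succ_eq_add_one, zero_add, one_pow, Finset.card_le_one]
    intro a ha b hb
    rw [P.mem_level, List.length_eq_zero_iff] at ha hb
    exact Subtype.ext (ha.trans hb.symm)
  · intro t ht hc
    refine (chainsBounded_of_chainHeight_le (h _ hn) t ht hc).trans ?_
    rw [pow_add]
    have h₁ : C ≤ (x.1.length + 1) ^ C :=
      (Nat.lt_two_pow_self).le.trans (Nat.pow_le_pow_left (by omega) C)
    gcongr
    omega

end WordPoset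

theorem proposition3p2 (P : WordPoset) (hheight : P.PolynomialHeight)
    (hinc : P.PolyTimeIncidence) (η : P.carrier → P.carrier → ℤ)
    (huni : P.Unitriangular η) (hη : P.GapPOn η) :
    (∃! ρ : P.carrier → P.carrier → ℤ, P.IsInverse η ρ) ∧
      ∀ ρ : P.carrier → P.carrier → ℤ, P.IsInverse η ρ → P.GapPOn ρ := by
  refine ⟨⟨_, huni.isInverse_chainSum, fun ρ hρ => ?_⟩, fun ρ hρ => ?_⟩
  · funext x y
    exact hρ.eq_chainSum huni (WordPoset.chainsBounded_card x) y
  · obtain ⟨c, hc⟩ := hheight.exists_chainsBounded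
    have h := isGapP_chainSum hη c
    unfold WordPoset.GapPOn
    convert h using 2 with w
    unfold WordPoset.extend
    split_ifs with hw
    · exact hρ.eq_chainSum huni (hc ⟨w 0, hw.1⟩) ⟨w 1, hw.2⟩
    · exact (WordPoset.chainSum_of_notMem hw).symm
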